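/- Let $0<\gamma<1$ and $T>0$. Write $\mathcal F f(\omega)=\int_{\mathbb R}f(x)e^{-i\omega x}\,dx$ (extended to $L^2(\mathbb R)$, complex valued) and $E_{\gamma,1}(z)=\sum_{n\ge 0}z^n/\Gamma(\gamma n+1)$. There is exactly one bounded linear operator $\mathbf K:L^2(\mathbb R)\to L^2(\mathbb R)$ that maps each initial state $\theta_0=u(\cdot,0)$ to the final state $u(\cdot,T)$ of the time-fractional heat equation $\partial_t^\gamma u-\Delta u=0$ on $\mathbb R\times(0,T)$; here a solution is a $u\in C([0,T];L^2(\mathbb R))$ such that for every Schwartz function $\phi$ the function $f(t)=\int u(x,t)\phi(x)\,dx$ is differentiable on $(0,T)$, $f'$ is integrable on $(0,T)$, $s\mapsto(t-s)^{-\gamma}f'(s)$ is integrable on $(0,t)$ for $0<t<T$, and $\frac1{\Gamma(1-\gamma)}\int_0^t(t-s)^{-\gamma}f'(s)\,ds=\int u(x,t)\Delta\phi(x)\,dx$ for $0<t<T$; every $\theta_0\in L^2(\mathbb R)$ has a solution, and every solution with initial state $\theta_0$ has final state $\mathbf K\theta_0$. Let $\Lambda=\mathbb Z^2$, $\lambda=(\lambda_D,\lambda_T)\in\Lambda$,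 let $\psi\in L^2(\mathbb R)$ be such that $u_\lambda(x)=2^{\lambda_D/2}\psi(2^{\lambda_D}x-\lambda_T)$, $\lambda\in\Lambda$, is an orthonormal basis of $L^2(\mathbb R)$, and assume that $\operatorname{supp}\mathcal F\psi\subset\{\omega\in\mathbb R: a_u\le|\omega|\le b_u\}$ with constants $a_u,b_u>0$. Put $\kappa_\lambda=2^{-2\lambda_D}$ if $\lambda_D\ge1$ and $\kappa_\lambda=1$ if $\lambda_D<1$, and $$v_\lambda=\kappa_\lambda\,\mathbf K\,\mathcal F^{-1}\big(|E_{\gamma,1}(-|\omega|^2T^\gamma)|^{-2}\mathcal Fu_\lambda\big).$$ Then $v_\lambda\in L^2(\mathbb R)$ is well defined, $\mathcal Fv_\lambda=\kappa_\lambda E_{\gamma,1}(-|\omega|^2T^\gamma)^{-1}\mathcal Fu_\lambda$, and the following hold. (a) $(u_\lambda,v_\lambda,\kappa_\lambda)_{\lambda\in\Lambda}$ is a diagonal frame decomposition (DFD) of $\mathbf K$: $\{u_\lambda\}$ is a frame over $(\ker\mathbf K)^\perp$, $\{v_\lambda\}$ is a frame over $\overline{\operatorname{ran}\mathbf K}$,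 $\kappa_\lambda>0$ and $\mathbf K^*v_\lambda=\kappa_\lambda u_\lambda$ for all $\lambda$. (A family $\{w_\lambda\}\subset H$ is a frame over the subspace $H$ if $A\|x\|^2\le\sum_\lambda|\langle x,w_\lambda\rangle|^2\le B\|x\|^2$ for all $x\in H$, with constants $A,B>0$.) (b) Let $p\ge0$ and $\varphi(\mu)=\mu^{p/2}$. If $\theta_0\in H^p(\mathbb R)$, then $\theta_0\in\mathbf M_{\varphi,E}=\{x\in L^2(\mathbb R):\sum_\lambda\varphi(\kappa_\lambda^2)^{-1}|\langle x,u_\lambda\rangle|^2\le E^2\}$ for all sufficiently large $E$. (c) Let $p\ge0$, $\varphi(\mu)=\mu^{p/2}$, $E>0$ and $\beta=2^{-(2+p)}$. There is a $\delta_0>0$ with $(0,\delta_0]\subset\bigcup_{\lambda\in\Lambda}D_{\lambda,\beta}$, where $D_{\lambda,\beta}=[\delta_\lambda^*,\beta^{-1}\delta_\lambda^*]$, $\delta^*_\lambda=|\mathbf v|_{\inf}^{-1}E\sqrt{\kappa_\lambda^2\varphi(\kappa_\lambda^2)}$ and $|\mathbf v|_{\inf}=\inf\{(\sum_\lambda|\langle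 x,v_\lambda\rangle|^2)^{1/2}: x\in\overline{\operatorname{ran}\mathbf K},\ \|x\|=1\}$. -/

import Mathlib

open MeasureTheory Set
open scoped FourierTransform SchwartzMap Laplacian ENNReal

noncomputable section

/-! ### Frames and diagonal frame decompositions -/

section Frames

variable {X Y Λ : Type*}
  [NormedAddCommGroup X] [InnerProductSpace ℂ X] [CompleteSpace X]
  [NormedAddCommGroup Y] [InnerProductSpace ℂ Y] [CompleteSpace Y]

/-- `w` is a frame over the subspace `H`: a family of elements of `H` for which there are frame
bounds `0 < A, B` with `A ‖x‖² ≤ ∑ |⟨x, w_λ⟩|² ≤ B ‖x‖²` for all `x ∈ H`. -/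
structure IsFrameOver (H : Submodule ℂ X) (w : Λ → X) : Prop where
  mem : ∀ l, w l ∈ H
  bounds : ∃ A B : ℝ, 0 < A ∧ 0 < B ∧ ∀ x ∈ H,
    Summable (fun l => ‖inner ℂ x (w l)‖ ^ 2) ∧
      A * ‖x‖ ^ 2 ≤ ∑' l, ‖inner ℂ x (w l)‖ ^ 2 ∧
      ∑' l, ‖inner ℂ x (w l)‖ ^ 2 ≤ B * ‖x‖ ^ 2

/-- `‖x‖_w = (∑ |⟨x, w_λ⟩|²)^{1/2}`. -/
def frameNorm (w : Λ → X) (x : X) : ℝ :=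
  Real.sqrt (∑' l, ‖inner ℂ x (w l)‖ ^ 2)

/-- `|w|_inf = inf {‖x‖_w : x ∈ H, ‖x‖ = 1}` for a frame `w` over `H`. -/
def frameInf (H : Submodule ℂ X) (w : Λ → X) : ℝ :=
  sInf {r : ℝ | ∃ x ∈ H, ‖x‖ = 1 ∧ r = frameNorm w x}

/-- `(u, v, κ)` is a diagonal frame decomposition (DFD) of the bounded operator `K`. -/
structure IsDFD (K : X →L[ℂ] Y) (u : Λ → X) (v : Λ → Y) (κ : Λ → ℝ) : Prop where
  frame_u : IsFrameOver (LinearMap.ker (K : X →ₗ[ℂ] Y))ᗮ u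
  frame_v : IsFrameOver (LinearMap.range (K : X →ₗ[ℂ] Y)).topologicalClosure v
  kappa_pos : ∀ l, 0 < κ l
  quasi_singular : ∀ l, ContinuousLinearMap.adjoint K (v l) = (κ l : ℂ) • u l

/-- The source set `M_{φ,E} = {x : ∑ φ(κ_λ²)⁻¹ |⟨x, u_λ⟩|² ≤ E²}`. -/
def sourceSet (u : Λ → X) (κ : Λ → ℝ) (φ : ℝ → ℝ) (E : ℝ) : Set X :=
  {x | Summable (fun l => (φ (κ l ^ 2))⁻¹ * ‖inner ℂ x (u l)‖ ^ 2) ∧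
    ∑' l, (φ (κ l ^ 2))⁻¹ * ‖inner ℂ x (u l)‖ ^ 2 ≤ E ^ 2}

/-- `δ*_λ = |v|_inf⁻¹ E √(κ_λ² φ(κ_λ²))`, where `v` is regarded as a frame over the closure of the
range of `K`. -/
def deltaStar (K : X →L[ℂ] Y) (v : Λ → Y) (κ : Λ → ℝ) (φ : ℝ → ℝ) (E : ℝ) (l : Λ) : ℝ :=
  (frameInf (LinearMap.range (K : X →ₗ[ℂ] Y)).topologicalClosure v)⁻¹ * E *
    Real.sqrt (κ l ^ 2 * φ (κ l ^ 2))

/-- `D_{λ,β} = [δ*_λ, β⁻¹ δ*_λ]`. -/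
def dSet (K : X →L[ℂ] Y) (v : Λ → Y) (κ : Λ → ℝ) (φ : ℝ → ℝ) (E β : ℝ) (l : Λ) : Set ℝ :=
  Icc (deltaStar K v κ φ E l) (β⁻¹ * deltaStar K v κ φ E l)

end Frames

/-! ### The time-fractional heat equation on the line -/

/-- The complex Hilbert space `L²(ℝ)`. -/
abbrev L2R : Type := Lp ℂ 2 (volume : Measure ℝ)

/-- The Mittag-Leffler function `E_{a,b}` at real arguments. -/
def mittagLeffler (a b z : ℝ) : ℝ :=
  ∑' n : ℕ, z ^ n / Real.Gamma (a * n + b)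

/-- The Caputo derivative of order `0 < γ < 1` started at time `0`. -/
def caputoDeriv (γ : ℝ) (f : ℝ → ℂ) (t : ℝ) : ℂ :=
  ((1 / Real.Gamma (1 - γ) : ℝ) : ℂ) *
    ∫ s in (0 : ℝ)..t, (((t - s) ^ (-γ) : ℝ) : ℂ) * deriv f s

/-- The (bilinear) pairing of an `L²` function with a Schwartz function. -/
def pairing (g : L2R) (φ : 𝓢(ℝ, ℂ)) : ℂ := ∫ x, g x * φ x

/-- `u ∈ C([0,T]; L²(ℝ))` solves `∂_t^γ u - Δ u = 0` on `ℝ × (0,T)` with `u(0) = θ₀`: the equation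
is understood weakly in space (Schwartz test functions) and in the classical Caputo sense in
time. -/
structure IsFracHeatSolution (γ T : ℝ) (θ₀ : L2R) (u : ℝ → L2R) : Prop where
  cont : ContinuousOn u (Icc 0 T)
  init : u 0 = θ₀
  differentiable : ∀ φ : 𝓢(ℝ, ℂ), DifferentiableOn ℝ (fun t => pairing (u t) φ) (Ioo 0 T)
  integrable : ∀ φ : 𝓢(ℝ, ℂ), IntegrableOn (deriv fun t => pairing (u t) φ) (Ioo 0 T)
  integrable_kernel : ∀ φ : 𝓢(ℝ, ℂ), ∀ t ∈ Ioo 0 T,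
    IntegrableOn (fun s => (((t - s) ^ (-γ) : ℝ) : ℂ) * deriv (fun r => pairing (u r) φ) s)
      (Ioo 0 t)
  eqn : ∀ φ : 𝓢(ℝ, ℂ), ∀ t ∈ Ioo 0 T,
    caputoDeriv γ (fun r => pairing (u r) φ) t - pairing (u t) (Δ φ) = 0

/-- `K` is the operator `θ₀ = u(·,0) ↦ θ_T = u(·,T)` of the fractional heat equation: every initial
state has a solution, and every solution with initial state `θ₀` has final state `K θ₀`. -/
def IsFinalStateOperator (γ T : ℝ) (K : L2R →L[ℂ] L2R) : Prop :=
  ∀ θ₀ : L2R, (∃ u, IsFracHeatSolution γ T θ₀ u) ∧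
    ∀ u, IsFracHeatSolution γ T θ₀ u → u T = K θ₀

/-- The function `ω ↦ E_{γ,1}(-|ω|² T^γ)` of the angular frequency `ω = 2πξ`. Mathlib's Fourier
transform is `𝓕 f ξ = ∫ e^{-2πixξ} f(x) dx`, that is, the value at `ω = 2πξ` of
`∫ e^{-iωx} f(x) dx`. -/
def fracSymbol (γ T ξ : ℝ) : ℝ :=
  mittagLeffler γ 1 (-(|2 * Real.pi * ξ| ^ 2 * T ^ γ))

/-! ### Wavelets -/

/-- The wavelet `ψ^{j,k}(x) = 2^{j/2} ψ(2^j x - k)`, `(j,k) = l`. -/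
def waveletFun (ψ : ℝ → ℂ) (l : ℤ × ℤ) (x : ℝ) : ℂ :=
  (((2 : ℝ) ^ ((l.1 : ℝ) / 2) : ℝ) : ℂ) * ψ ((2 : ℝ) ^ l.1 * x - (l.2 : ℝ))

/-- `κ_λ = 2^{-2λ_D}` if `λ_D ≥ 1`, and `κ_λ = 1` if `λ_D < 1`, for `λ = (λ_D, λ_T)`. -/
def waveletKappa (l : ℤ × ℤ) : ℝ :=
  if 1 ≤ l.1 then (2 : ℝ) ^ (-2 * l.1) else 1

end

/-!
On the Fourier side the fractional heat equation decouples into the relaxation equations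
`∂_t^γ f = -ω² f`, which are solved by `E_{γ,1}(-ω² t ^ γ)`. The final state operator `K` is therefore
the Fourier multiplier with symbol `E_{γ,1}(-ω² T ^ γ)`.

The Mittag-Leffler function is controlled by an extremum principle for the Caputo derivative
(`integral_sub_rpow_mul_deriv_le_of_isMin`): where `g` attains its minimum over the past `[0, t]`,
the Caputo integral is at most `t ^ (-γ) (g t - g 0)`. The resulting comparison principle shows that
`x ↦ E_{γ,1}(-x)` is nonnegative and decreasing on `x ≥ 0`. The extremum principle and the Volterra
form of the equation then give
`1 / (1 + Γ(1 - γ) x) ≤ E_{γ,1}(-x) ≤ 1 / (1 + x / Γ(1 + γ))`, and `0 ≤ E_{γ,γ}(-x) ≤ 1 / Γ(γ)`. The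
last bound lets one differentiate under the Fourier integral, which gives existence
(`isFracHeatSolution_fracHeat`).

For uniqueness, let `d` be a solution with zero initial state and `φ` a test function with
frequencies `|ω| ≤ R`. Since `∂_t^γ ⟨d, φ⟩ = ⟨d, Δφ⟩`, comparison with powers of `t` and induction on
`n` yield `|⟨d(t), φ⟩| ≤ M ‖φ‖ (R² t ^ γ)^n / Γ(γ n + 1)`, the terms of a convergent series. Hence
`⟨d(t), φ⟩ = 0` for all such `φ`, and these are dense.

The Fourier transform of `u_{j,k}` lives in an annulus `|ω| ∼ 2 ^ j` (`fourier_wavelet_support`),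
where the two-sided bound makes both `κ_λ E_{γ,1}⁻¹` and its inverse bounded uniformly in `λ`.
Bessel's inequality on each scale and the finite overlap of the annuli show that the vaguelettes
`v_λ` and the dual family `κ_λ⁻¹ K u_λ` are Bessel families (`bessel_of_annulus_support`). The two
are biorthogonal, so the Bessel bound of the dual family is a lower frame bound for `v`
(`norm_sq_le_of_biorthogonal_bessel`). The same Bessel estimate, with the weight
`κ_λ ^ (-p/2) (1 + ξ²) ^ (-p/2)`, places Sobolev functions into the source sets.
-/

/-! ### The Mittag-Leffler function -/

/-- The integral defining the Gamma function, restricted to `(R, ∞)`, gives a geometric lower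
bound, which makes the Mittag-Leffler series converge everywhere. -/
lemma rpow_mul_exp_neg_le_Gamma {R y : ℝ} (hR : 0 < R) (hy : 1 ≤ y) :
    R ^ (y - 1) * Real.exp (-R) ≤ Real.Gamma y := by
  have hy0 : 0 < y := by linarith
  rw [Real.Gamma_eq_integral hy0]
  have hint := Real.GammaIntegral_convergent hy0
  have h1 : ∫ x in Ioi R, R ^ (y - 1) * Real.exp (-x) = R ^ (y - 1) * Real.exp (-R) := by
    rw [integral_const_mul, integral_exp_neg_Ioi]
  have hsub : Ioi R ⊆ Ioi (0 : ℝ) := Ioi_subset_Ioi hR.le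
  calc R ^ (y - 1) * Real.exp (-R) = ∫ x in Ioi R, R ^ (y - 1) * Real.exp (-x) := h1.symm
    _ ≤ ∫ x in Ioi R, Real.exp (-x) * x ^ (y - 1) := by
        refine setIntegral_mono_on ((integrableOn_exp_neg_Ioi R).const_mul _)
          (hint.mono_set hsub) measurableSet_Ioi fun x hx => ?_
        rw [mul_comm]
        have : R ^ (y - 1) ≤ x ^ (y - 1) :=
          Real.rpow_le_rpow hR.le (le_of_lt hx) (by linarith)
        gcongr
    _ ≤ ∫ x in Ioi 0, Real.exp (-x) * x ^ (y - 1) := by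
        refine setIntegral_mono_set hint ?_ hsub.eventuallyLE
        filter_upwards [ae_restrict_mem measurableSet_Ioi] with x hx
        have : (0 : ℝ) < x := hx
        positivity

lemma mittagLeffler_index_pos {a b : ℝ} (ha : 0 < a) (hb : 0 < b) (n : ℕ) : 0 < a * n + b := by
  positivity

lemma Gamma_mittagLeffler_index_pos {a b : ℝ} (ha : 0 < a) (hb : 0 < b) (n : ℕ) :
    0 < Real.Gamma (a * n + b) := Real.Gamma_pos_of_pos (mittagLeffler_index_pos ha hb n)

lemma summable_mittagLeffler {a b : ℝ} (ha : 0 < a) (hb : 0 < b) (z : ℝ) :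
    Summable fun n : ℕ => z ^ n / Real.Gamma (a * n + b) := by
  -- `R` is chosen with `|z| / R ^ a = 1 / 2`, up to the shift making it positive
  set R : ℝ := (2 * (|z| + 1)) ^ (1 / a) with hRdef
  have hR : 0 < R := by positivity
  have hRa : R ^ a = 2 * (|z| + 1) := by
    rw [hRdef, ← Real.rpow_mul (by positivity), one_div_mul_cancel ha.ne', Real.rpow_one]
  refine Summable.of_norm_bounded_eventually_nat
    (g := fun n : ℕ => (R ^ (1 - b) * Real.exp R) * (1 / 2) ^ n)
    (summable_geometric_two.mul_left _) ?_
  filter_upwards [Filter.eventually_ge_atTop ⌈1 / a⌉₊] with n hn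
  have hn' : 1 ≤ a * n := by
    have := Nat.ceil_le.mp hn
    rwa [div_le_iff₀ ha, mul_comm] at this
  have hG := rpow_mul_exp_neg_le_Gamma hR (y := a * n + b) (by linarith)
  have hGpos : 0 < R ^ (a * n + b - 1) * Real.exp (-R) := by positivity
  rw [norm_div, norm_pow, Real.norm_eq_abs, Real.norm_eq_abs,
    abs_of_pos (hGpos.trans_le hG)]
  have hsplit : R ^ (a * n + b - 1) = (R ^ a) ^ n * R ^ (b - 1) := by
    rw [← Real.rpow_natCast, ← Real.rpow_mul hR.le, ← Real.rpow_add hR]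
    ring_nf
  calc |z| ^ n / Real.Gamma (a * n + b)
      ≤ |z| ^ n / (R ^ (a * n + b - 1) * Real.exp (-R)) := by gcongr
    _ = (R ^ (1 - b) * Real.exp R) * (|z| / R ^ a) ^ n := by
        rw [hsplit, Real.exp_neg, show (1 - b) = -(b - 1) by ring, Real.rpow_neg hR.le, div_pow]
        have : R ^ (b - 1) ≠ 0 := by positivity
        have : (R ^ a) ^ n ≠ 0 := by positivity
        field_simp
    _ ≤ (R ^ (1 - b) * Real.exp R) * (1 / 2) ^ n := by
        have : |z| / R ^ a ≤ 1 / 2 := by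
          rw [hRa, div_le_div_iff₀ (by positivity) (by norm_num)]
          linarith
        gcongr

lemma continuous_mittagLeffler {a b : ℝ} (ha : 0 < a) (hb : 0 < b) :
    Continuous (mittagLeffler a b) := by
  rw [continuous_iff_continuousAt]
  intro z
  have hon : ContinuousOn (mittagLeffler a b) (Metric.ball 0 (|z| + 1)) := by
    refine continuousOn_tsum (u := fun n : ℕ => (|z| + 1) ^ n / Real.Gamma (a * n + b))
      (fun n => by fun_prop) (summable_mittagLeffler ha hb _) fun n x hx => ?_
    rw [norm_div, norm_pow, Real.norm_of_nonneg (Gamma_mittagLeffler_index_pos ha hb n).le]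
    have h1 : ‖x‖ ≤ |z| + 1 := by simpa using (mem_ball_zero_iff.mp hx).le
    have := (Gamma_mittagLeffler_index_pos ha hb n).le
    gcongr
  exact hon.continuousAt (Metric.isOpen_ball.mem_nhds (by simp))

lemma mittagLeffler_zero (a : ℝ) {b : ℝ} : mittagLeffler a b 0 = 1 / Real.Gamma b := by
  rw [mittagLeffler, tsum_eq_single 0]
  · simp
  · intro n hn
    simp [hn]

lemma mittagLeffler_eq_add {a b : ℝ} (ha : 0 < a) (hb : 0 < b) (z : ℝ) :
    mittagLeffler a b z = 1 / Real.Gamma b + z * mittagLeffler a (b + a) z := by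
  rw [mittagLeffler, (summable_mittagLeffler ha hb z).tsum_eq_zero_add, mittagLeffler,
    ← tsum_mul_left]
  congr 1
  · simp
  · refine tsum_congr fun n => ?_
    rw [show a * ((n + 1 : ℕ) : ℝ) + b = a * n + (b + a) by push_cast; ring, pow_succ]
    ring

lemma hasDerivAt_mittagLeffler {a : ℝ} (ha : 0 < a) (z : ℝ) :
    HasDerivAt (mittagLeffler a 1) (a⁻¹ * mittagLeffler a a z) z := by
  have key : ∀ n : ℕ, ((n + 1 : ℕ) : ℝ) / Real.Gamma (a * ((n + 1 : ℕ) : ℝ) + 1)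
      = a⁻¹ / Real.Gamma (a * n + a) := by
    intro n
    have h0 : a * ((n + 1 : ℕ) : ℝ) ≠ 0 := by positivity
    rw [Real.Gamma_add_one h0]
    have h1 := (Gamma_mittagLeffler_index_pos ha ha n).ne'
    rw [show a * ((n + 1 : ℕ) : ℝ) = a * n + a by push_cast; ring] at h0 ⊢
    have : ((n + 1 : ℕ) : ℝ) = (a * n + a) / a := by field_simp; push_cast; ring
    rw [this]
    field_simp
  -- the derivatives of the terms and a summable bound on `|y| < |z| + 1`
  set g' : ℕ → ℝ → ℝ := fun n y => n * y ^ (n - 1) / Real.Gamma (a * n + 1)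
  set M := |z| + 1
  set w : ℕ → ℝ := fun n => n * M ^ (n - 1) / Real.Gamma (a * n + 1)
  have hshift : ∀ (y : ℝ) (n : ℕ), ((n + 1 : ℕ) : ℝ) * y ^ (n + 1 - 1) /
      Real.Gamma (a * ((n + 1 : ℕ) : ℝ) + 1) = a⁻¹ * (y ^ n / Real.Gamma (a * n + a)) := by
    intro y n
    rw [Nat.add_sub_cancel, mul_div_right_comm, key n]
    ring
  have hw : Summable w := by
    rw [← summable_nat_add_iff 1]
    simp only [w, hshift]
    exact (summable_mittagLeffler ha ha M).mul_left _
  have hd := hasDerivAt_tsum_of_isPreconnected (g := fun (n : ℕ) y => y ^ n / Real.Gamma (a * n + 1))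
    (g' := g') hw (Metric.isOpen_ball (x := (0 : ℝ)) (ε := M))
    (convex_ball (0 : ℝ) M).isPreconnected
    (fun n y _ => (hasDerivAt_pow n y).div_const _)
    (fun n y hy => by
      rw [norm_div, norm_mul, norm_pow,
        Real.norm_of_nonneg (Gamma_mittagLeffler_index_pos ha one_pos n).le,
        Real.norm_of_nonneg (Nat.cast_nonneg n)]
      have h1 : ‖y‖ ≤ M := (mem_ball_zero_iff.mp hy).le
      have := (Gamma_mittagLeffler_index_pos ha one_pos n).le
      simp only [w]
      gcongr)
    (y₀ := z) (by simp [M]) (summable_mittagLeffler ha one_pos z) (y := z) (by simp [M])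
  have hsum : ∑' n, g' n z = a⁻¹ * mittagLeffler a a z := by
    have hs : Summable fun n => g' n z := by
      rw [← summable_nat_add_iff 1]
      simp only [g', hshift]
      exact (summable_mittagLeffler ha ha z).mul_left _
    rw [hs.tsum_eq_zero_add, mittagLeffler, ← tsum_mul_left]
    simp only [g', hshift]
    simp
  rw [hsum] at hd
  exact hd

/-- Euler's beta integral on `[0, t]`. -/
lemma integral_sub_rpow_mul_rpow {b c t : ℝ} (hb : 0 < b) (hc : 0 < c) (ht : 0 < t) :
    ∫ s in (0 : ℝ)..t, (t - s) ^ (c - 1) * s ^ (b - 1) =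
      t ^ (b + c - 1) * (Real.Gamma b * Real.Gamma c / Real.Gamma (b + c)) := by
  have h := Complex.betaIntegral_scaled (b : ℂ) (c : ℂ) ht
  rw [Complex.betaIntegral_eq_Gamma_mul_div _ _ (by simpa) (by simpa), Complex.Gamma_ofReal,
    Complex.Gamma_ofReal, ← Complex.ofReal_add, Complex.Gamma_ofReal] at h
  have h2 : ∫ x in (0 : ℝ)..t, (x : ℂ) ^ ((b : ℂ) - 1) * ((t : ℂ) - x) ^ ((c : ℂ) - 1) =
      ((∫ s in (0 : ℝ)..t, (t - s) ^ (c - 1) * s ^ (b - 1) : ℝ) : ℂ) := by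
    rw [← intervalIntegral.integral_ofReal]
    refine intervalIntegral.integral_congr fun x hx => ?_
    rw [uIcc_of_le ht.le] at hx
    rw [Complex.ofReal_mul, Complex.ofReal_cpow (by linarith [hx.2]),
      Complex.ofReal_cpow hx.1, mul_comm]
    push_cast
    rfl
  rw [h2] at h
  apply Complex.ofReal_injective
  rw [h]
  push_cast
  rw [Complex.ofReal_cpow ht.le]
  push_cast
  rfl

lemma intervalIntegrable_sub_rpow_mul_rpow {b c t : ℝ} (hb : 0 < b) (hc : 0 < c) (ht : 0 < t) :
    IntervalIntegrable (fun s => (t - s) ^ (c - 1) * s ^ (b - 1)) volume 0 t := by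
  -- a function whose Bochner integral is nonzero is integrable
  apply intervalIntegral.intervalIntegrable_of_integral_ne_zero
  rw [integral_sub_rpow_mul_rpow hb hc ht]
  have := Real.Gamma_pos_of_pos hb
  have := Real.Gamma_pos_of_pos hc
  have := Real.Gamma_pos_of_pos (add_pos hb hc)
  positivity

lemma integrableOn_sub_rpow_mul_rpow {b c t : ℝ} (hb : 0 < b) (hc : 0 < c) (ht : 0 < t) :
    IntegrableOn (fun s => (t - s) ^ (c - 1) * s ^ (b - 1)) (Ioo 0 t) :=
  ((intervalIntegrable_iff_integrableOn_Ioo_of_le ht.le).mp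
    (intervalIntegrable_sub_rpow_mul_rpow hb hc ht))

/-- The fractional integral of order `c` maps `s ^ (b - 1) E_{a,b}(-x s ^ a)` to
`t ^ (b + c - 1) E_{a,b+c}(-x t ^ a)`: integrate the power series term by term. -/
lemma integral_sub_rpow_mul_mittagLeffler {a b c t : ℝ} (ha : 0 < a) (hb : 0 < b) (hc : 0 < c)
    (ht : 0 < t) (x : ℝ) :
    ∫ s in (0 : ℝ)..t, (t - s) ^ (c - 1) * (s ^ (b - 1) * mittagLeffler a b (-(x * s ^ a))) =
      Real.Gamma c * (t ^ (b + c - 1) * mittagLeffler a (b + c) (-(x * t ^ a))) := by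
  set F : ℕ → ℝ → ℝ := fun n s =>
    ((-x) ^ n / Real.Gamma (a * n + b)) * ((t - s) ^ (c - 1) * s ^ ((a * n + b) - 1)) with hF
  have hterm : ∀ (z : ℝ) (n : ℕ),
      (z ^ n / Real.Gamma (a * n + b)) * (t ^ ((a * n + b) + c - 1) *
        (Real.Gamma (a * n + b) * Real.Gamma c / Real.Gamma ((a * n + b) + c))) =
      Real.Gamma c * t ^ (b + c - 1) * ((z * t ^ a) ^ n / Real.Gamma (a * n + (b + c))) := by
    intro z n
    have h1 := (Gamma_mittagLeffler_index_pos ha hb n).ne'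
    rw [show (a * n + b) + c = a * n + (b + c) by ring,
      show a * n + (b + c) - 1 = a * n + (b + c - 1) by ring, Real.rpow_add ht, mul_pow,
      ← Real.rpow_natCast (t ^ a), ← Real.rpow_mul ht.le]
    field_simp
  have hFint : ∀ n, ∫ s in (0 : ℝ)..t, F n s =
      Real.Gamma c * t ^ (b + c - 1) * ((-x * t ^ a) ^ n / Real.Gamma (a * n + (b + c))) := by
    intro n
    rw [hF, intervalIntegral.integral_const_mul,
      integral_sub_rpow_mul_rpow (mittagLeffler_index_pos ha hb n) hc ht, hterm]
  have hFi : ∀ n, Integrable (F n) (volume.restrict (Ioc 0 t)) := fun n =>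
    ((intervalIntegrable_sub_rpow_mul_rpow (mittagLeffler_index_pos ha hb n) hc ht).const_mul _).1
  have hFnorm : ∀ n, ∫ s in Ioc 0 t, ‖F n s‖ =
      Real.Gamma c * t ^ (b + c - 1) * ((|x| * t ^ a) ^ n / Real.Gamma (a * n + (b + c))) := by
    intro n
    rw [← hterm |x| n, ← integral_sub_rpow_mul_rpow (mittagLeffler_index_pos ha hb n) hc ht,
      intervalIntegral.integral_of_le ht.le, ← integral_const_mul]
    refine setIntegral_congr_fun measurableSet_Ioc fun s hs => ?_
    have h1 := (Gamma_mittagLeffler_index_pos ha hb n)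
    have h2 : 0 ≤ t - s := by linarith [hs.2]
    have h3 := hs.1.le
    simp only [hF]
    rw [norm_mul, norm_div, norm_pow, norm_neg, Real.norm_of_nonneg h1.le, Real.norm_eq_abs,
      Real.norm_of_nonneg (by positivity)]
  have hs := hasSum_integral_of_summable_integral_norm hFi (by
    simp only [hFnorm]
    exact (summable_mittagLeffler ha (add_pos hb hc) _).mul_left _)
  have hL : ∫ s in (0 : ℝ)..t, (t - s) ^ (c - 1) *
      (s ^ (b - 1) * mittagLeffler a b (-(x * s ^ a))) = ∫ s in Ioc 0 t, ∑' n, F n s := by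
    rw [intervalIntegral.integral_of_le ht.le]
    refine setIntegral_congr_fun measurableSet_Ioc fun s hs => ?_
    simp only [hF]
    rw [mittagLeffler, ← tsum_mul_left, ← tsum_mul_left]
    refine tsum_congr fun n => ?_
    rw [show a * n + b - 1 = a * n + (b - 1) by ring, Real.rpow_add hs.1, ← neg_mul, mul_pow,
      ← Real.rpow_natCast (s ^ a), ← Real.rpow_mul hs.1.le]
    ring
  rw [hL, ← hs.tsum_eq, mittagLeffler, ← mul_assoc, ← tsum_mul_left]
  refine tsum_congr fun n => ?_
  rw [← intervalIntegral.integral_of_le ht.le, hFint, neg_mul]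

/-! ### An extremum principle for the Caputo derivative -/

/-- The extremum principle: at a point where `g` attains its minimum over the past `[0, t]`, the
Caputo integral is at most `t ^ (-γ) (g t - g 0)`. The function
`P s = (t - s) ^ (-γ) (g s - g t)` vanishes at `t` and
`P' s = (t - s) ^ (-γ) g' s + γ (t - s) ^ (-γ - 1) (g s - g t)`, where the last term is
nonnegative. -/
lemma integral_sub_rpow_mul_deriv_le_of_isMin {γ t : ℝ} {g : ℝ → ℝ} (hγ0 : 0 < γ) (hγ1 : γ < 1)
    (ht : 0 < t) (hcont : ContinuousOn g (Icc 0 t)) (hd : DifferentiableOn ℝ g (Ioo 0 t))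
    (hdt : DifferentiableAt ℝ g t)
    (hint : IntegrableOn (fun s => (t - s) ^ (-γ) * deriv g s) (Ioo 0 t))
    (hmin : ∀ s ∈ Icc 0 t, g t ≤ g s) :
    ∫ s in (0 : ℝ)..t, (t - s) ^ (-γ) * deriv g s ≤ t ^ (-γ) * (g t - g 0) := by
  set P : ℝ → ℝ := fun s => (t - s) ^ (-γ) * (g s - g t) with hP
  have hPt : P t = 0 := by simp [hP]
  have hPcont : ContinuousOn P (Icc 0 t) := by
    intro s hs
    rcases eq_or_lt_of_le hs.2 with rfl | hst
    · -- near `t` the difference `g s - g t` is `O (t - s)` and `γ < 1`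
      obtain ⟨C, hC⟩ := hdt.isBigO_sub.bound
      have hlim : Filter.Tendsto (fun r => C * (s - r) ^ (1 - γ)) (nhdsWithin s (Icc 0 s))
          (nhds 0) := by
        have hc : Continuous fun r : ℝ => C * (s - r) ^ (1 - γ) :=
          continuous_const.mul ((continuous_const.sub continuous_id).rpow_const
            fun _ => Or.inr (by linarith))
        have := (hc.tendsto s).mono_left (nhdsWithin_le_nhds (s := Icc 0 s))
        simpa [Real.zero_rpow (by linarith : 1 - γ ≠ 0)] using this
      rw [ContinuousWithinAt, hPt]
      refine squeeze_zero_norm' ?_ hlim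
      filter_upwards [mem_nhdsWithin_of_mem_nhds hC, self_mem_nhdsWithin] with r hr hrs
      rcases eq_or_lt_of_le hrs.2 with rfl | hrs'
      · simp [hPt, Real.zero_rpow (by linarith : 1 - γ ≠ 0)]
      · have hpos : 0 < s - r := by linarith
        have hr' : ‖g r - g s‖ ≤ C * (s - r) := by
          rwa [Real.norm_eq_abs (r - s), abs_sub_comm, abs_of_pos hpos] at hr
        rw [hP, norm_mul, Real.norm_of_nonneg (by positivity)]
        calc (s - r) ^ (-γ) * ‖g r - g s‖ ≤ (s - r) ^ (-γ) * (C * (s - r)) := by gcongr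
          _ = C * (s - r) ^ (1 - γ) := by
              rw [show 1 - γ = -γ + 1 by ring, Real.rpow_add hpos, Real.rpow_one]
              ring
    · refine ContinuousWithinAt.mul ?_ ((hcont s hs).sub continuousWithinAt_const)
      exact (((continuous_const.sub continuous_id).continuousAt).rpow_const
        (Or.inl (sub_pos.mpr hst).ne')).continuousWithinAt
  have hPd : ∀ s ∈ Ioo 0 t, HasDerivAt P
      (γ * (t - s) ^ (-γ - 1) * (g s - g t) + (t - s) ^ (-γ) * deriv g s) s := by
    intro s hs
    have hpos : 0 < t - s := by linarith [hs.2]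
    have h1 : HasDerivAt (fun r => (t - r) ^ (-γ)) (-1 * (-γ) * (t - s) ^ (-γ - 1)) s :=
      ((hasDerivAt_id s).const_sub t).rpow_const (Or.inl hpos.ne')
    have h2 : HasDerivAt (fun r => g r - g t) (deriv g s) s :=
      ((hd s hs).differentiableAt (isOpen_Ioo.mem_nhds hs)).hasDerivAt.sub_const _
    refine (h1.mul h2).congr_deriv ?_
    ring
  have hle := intervalIntegral.integral_le_sub_of_hasDeriv_right_of_le ht.le hPcont
    (fun s hs => (hPd s hs).hasDerivWithinAt)
    (φ := fun s => (t - s) ^ (-γ) * deriv g s)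
    ((integrableOn_Icc_iff_integrableOn_Ioo enorm_ne_top enorm_ne_top).mpr hint) (fun s hs => by
      have h1 : 0 < t - s := by linarith [hs.2]
      have h2 : 0 ≤ g s - g t := by linarith [hmin s ⟨hs.1.le, hs.2.le⟩]
      have : 0 ≤ γ * (t - s) ^ (-γ - 1) * (g s - g t) := by positivity
      linarith)
  refine hle.trans (le_of_eq ?_)
  rw [hPt]
  simp only [hP, sub_zero]
  ring

/-- Comparison principle: if the Caputo integral is nonnegative wherever `g` is negative, then `g`
cannot become negative. -/
lemma nonneg_of_caputo_nonneg {γ T : ℝ} {g : ℝ → ℝ} (hγ0 : 0 < γ) (hγ1 : γ < 1)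
    (hcont : ContinuousOn g (Icc 0 T)) (hd : DifferentiableOn ℝ g (Ioo 0 T))
    (hint : ∀ t ∈ Ioo 0 T, IntegrableOn (fun s => (t - s) ^ (-γ) * deriv g s) (Ioo 0 t))
    (h0 : 0 ≤ g 0)
    (hneg : ∀ t ∈ Ioo 0 T, g t < 0 → 0 ≤ ∫ s in (0 : ℝ)..t, (t - s) ^ (-γ) * deriv g s)
    {t : ℝ} (ht : t ∈ Ioo 0 T) : 0 ≤ g t := by
  by_contra! hlt
  have hsub : Icc 0 t ⊆ Icc 0 T := Icc_subset_Icc_right ht.2.le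
  obtain ⟨m, hm, hmin⟩ := isCompact_Icc.exists_isMinOn (nonempty_Icc.mpr ht.1.le)
    (hcont.mono hsub)
  have hgm : g m < 0 := (hmin (right_mem_Icc.mpr ht.1.le)).trans_lt hlt
  have hm0 : 0 < m := lt_of_le_of_ne hm.1 fun h => by rw [← h] at hgm; linarith
  have hmT : m ∈ Ioo 0 T := ⟨hm0, hm.2.trans_lt ht.2⟩
  have h1 := integral_sub_rpow_mul_deriv_le_of_isMin hγ0 hγ1 hm0
    (hcont.mono (Icc_subset_Icc_right hmT.2.le)) (hd.mono (Ioo_subset_Ioo_right hmT.2.le))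
    ((hd m hmT).differentiableAt (isOpen_Ioo.mem_nhds hmT)) (hint m hmT)
    (fun s hs => hmin ⟨hs.1, hs.2.trans hm.2⟩)
  have h2 := hneg m hmT hgm
  have h3 : 0 < m ^ (-γ) := by positivity
  nlinarith

/-! ### The relaxation function and bounds for the Mittag-Leffler function -/

lemma continuous_mittagLeffler_rpow {a b c : ℝ} (ha : 0 < a) (hb : 0 < b) (hc : 0 < c) (x : ℝ) :
    Continuous fun t : ℝ => mittagLeffler a b (-(x * t ^ c)) :=
  (continuous_mittagLeffler ha hb).comp
    (continuous_const.mul (continuous_id.rpow_const fun _ => Or.inr hc.le)).neg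

lemma hasDerivAt_mittagLeffler_rpow {γ : ℝ} (hγ : 0 < γ) (x : ℝ) {t : ℝ} (ht : 0 < t) :
    HasDerivAt (fun t : ℝ => mittagLeffler γ 1 (-(x * t ^ γ)))
      (-x * (t ^ (γ - 1) * mittagLeffler γ γ (-(x * t ^ γ)))) t := by
  have h1 : HasDerivAt (fun t : ℝ => -(x * t ^ γ)) (-(x * (γ * t ^ (γ - 1)))) t :=
    ((Real.hasDerivAt_rpow_const (Or.inl ht.ne')).const_mul x).neg
  refine ((hasDerivAt_mittagLeffler hγ _).comp t h1).congr_deriv ?_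
  field_simp

lemma deriv_mittagLeffler_rpow {γ : ℝ} (hγ : 0 < γ) (x : ℝ) {t : ℝ} (ht : 0 < t) :
    deriv (fun t : ℝ => mittagLeffler γ 1 (-(x * t ^ γ))) t =
      -x * (t ^ (γ - 1) * mittagLeffler γ γ (-(x * t ^ γ))) :=
  (hasDerivAt_mittagLeffler_rpow hγ x ht).deriv

lemma integrableOn_kernel_mul_deriv_mittagLeffler {γ : ℝ} (hγ0 : 0 < γ) (hγ1 : γ < 1) (x : ℝ)
    {t : ℝ} (ht : 0 < t) :
    IntegrableOn (fun s => (t - s) ^ (-γ) *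
      deriv (fun t : ℝ => mittagLeffler γ 1 (-(x * t ^ γ))) s) (Ioo 0 t) := by
  have h1 := intervalIntegrable_sub_rpow_mul_rpow hγ0 (sub_pos.mpr hγ1) ht
  have h2 := (h1.mul_continuousOn
    (continuous_mittagLeffler_rpow hγ0 hγ0 hγ0 x).continuousOn).const_mul (-x)
  refine ((intervalIntegrable_iff_integrableOn_Ioo_of_le ht.le).mp h2).congr_fun ?_
    measurableSet_Ioo
  intro s hs
  simp only
  rw [deriv_mittagLeffler_rpow hγ0 x hs.1, show 1 - γ - 1 = -γ by ring]
  ring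

/-- The relaxation function `E_{γ,1}(-x t ^ γ)` solves `∂_t^γ f = -x f`. -/
lemma integral_kernel_mul_deriv_mittagLeffler {γ : ℝ} (hγ0 : 0 < γ) (hγ1 : γ < 1) (x : ℝ)
    {t : ℝ} (ht : 0 < t) :
    ∫ s in (0 : ℝ)..t, (t - s) ^ (-γ) *
      (-x * (s ^ (γ - 1) * mittagLeffler γ γ (-(x * s ^ γ)))) =
      Real.Gamma (1 - γ) * (-x * mittagLeffler γ 1 (-(x * t ^ γ))) := by
  have h := integral_sub_rpow_mul_mittagLeffler hγ0 hγ0 (sub_pos.mpr hγ1) ht x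
  rw [show γ + (1 - γ) = 1 by ring, sub_self, Real.rpow_zero, one_mul,
    show 1 - γ - 1 = -γ by ring] at h
  rw [show Real.Gamma (1 - γ) * (-x * mittagLeffler γ 1 (-(x * t ^ γ))) =
    -x * (Real.Gamma (1 - γ) * mittagLeffler γ 1 (-(x * t ^ γ))) by ring, ← h,
    ← intervalIntegral.integral_const_mul]
  congr 1
  ext s
  ring

lemma integral_kernel_mul_deriv_mittagLeffler' {γ : ℝ} (hγ0 : 0 < γ) (hγ1 : γ < 1) (x : ℝ)
    {t : ℝ} (ht : 0 < t) :
    ∫ s in (0 : ℝ)..t, (t - s) ^ (-γ) *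
      deriv (fun t : ℝ => mittagLeffler γ 1 (-(x * t ^ γ))) s =
      Real.Gamma (1 - γ) * (-x * mittagLeffler γ 1 (-(x * t ^ γ))) := by
  rw [← integral_kernel_mul_deriv_mittagLeffler hγ0 hγ1 x ht,
    intervalIntegral.integral_of_le ht.le, intervalIntegral.integral_of_le ht.le]
  refine setIntegral_congr_fun measurableSet_Ioc fun s hs => ?_
  rw [deriv_mittagLeffler_rpow hγ0 x hs.1]

lemma mittagLeffler_neg_nonneg {γ : ℝ} (hγ0 : 0 < γ) (hγ1 : γ < 1) {x : ℝ} (hx : 0 ≤ x) :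
    0 ≤ mittagLeffler γ 1 (-x) := by
  have h := nonneg_of_caputo_nonneg (T := 2) hγ0 hγ1
    (continuous_mittagLeffler_rpow hγ0 one_pos hγ0 x).continuousOn
    (fun t ht => (hasDerivAt_mittagLeffler_rpow hγ0 x ht.1).differentiableAt.differentiableWithinAt)
    (fun t ht => integrableOn_kernel_mul_deriv_mittagLeffler hγ0 hγ1 x ht.1)
    (by simp [Real.zero_rpow hγ0.ne', mittagLeffler_zero])
    (fun t ht hlt => by
      rw [integral_kernel_mul_deriv_mittagLeffler' hγ0 hγ1 x ht.1]
      have := Real.Gamma_pos_of_pos (sub_pos.mpr hγ1)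
      have : 0 ≤ -x * mittagLeffler γ 1 (-(x * t ^ γ)) := by nlinarith
      positivity)
    (t := 1) ⟨one_pos, one_lt_two⟩
  simpa using h

/-- The difference `w` of the relaxation functions with rates `x ≤ y` has
`∂_t^γ w = -x w + (y - x) E_{γ,1}(-y t ^ γ)`, so the comparison principle applies to it. -/
lemma antitoneOn_mittagLeffler_neg {γ : ℝ} (hγ0 : 0 < γ) (hγ1 : γ < 1) :
    AntitoneOn (fun x => mittagLeffler γ 1 (-x)) (Ici 0) := by
  intro x hx y hy hxy
  have hx : 0 ≤ x := hx
  have hy : 0 ≤ y := hy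
  have hG := Real.Gamma_pos_of_pos (sub_pos.mpr hγ1)
  have hderiv : ∀ s : ℝ, 0 < s → deriv (fun t : ℝ => mittagLeffler γ 1 (-(x * t ^ γ)) -
      mittagLeffler γ 1 (-(y * t ^ γ))) s =
      deriv (fun t : ℝ => mittagLeffler γ 1 (-(x * t ^ γ))) s -
      deriv (fun t : ℝ => mittagLeffler γ 1 (-(y * t ^ γ))) s := fun s hs =>
    deriv_fun_sub (hasDerivAt_mittagLeffler_rpow hγ0 x hs).differentiableAt
      (hasDerivAt_mittagLeffler_rpow hγ0 y hs).differentiableAt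
  have h := nonneg_of_caputo_nonneg (T := 2)
    (g := fun t => mittagLeffler γ 1 (-(x * t ^ γ)) - mittagLeffler γ 1 (-(y * t ^ γ))) hγ0 hγ1
    ((continuous_mittagLeffler_rpow hγ0 one_pos hγ0 x).sub
      (continuous_mittagLeffler_rpow hγ0 one_pos hγ0 y)).continuousOn
    (fun t ht => ((hasDerivAt_mittagLeffler_rpow hγ0 x ht.1).differentiableAt.sub
      (hasDerivAt_mittagLeffler_rpow hγ0 y ht.1).differentiableAt).differentiableWithinAt)
    (fun t ht => by
      refine ((integrableOn_kernel_mul_deriv_mittagLeffler hγ0 hγ1 x ht.1).sub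
        (integrableOn_kernel_mul_deriv_mittagLeffler hγ0 hγ1 y ht.1)).congr_fun
        (fun s hs => ?_) measurableSet_Ioo
      simp only [Pi.sub_apply]
      rw [hderiv s hs.1]
      ring)
    (by simp [Real.zero_rpow hγ0.ne'])
    (fun t ht hlt => by
      have hI : ∫ s in (0 : ℝ)..t, (t - s) ^ (-γ) * deriv (fun t : ℝ =>
          mittagLeffler γ 1 (-(x * t ^ γ)) - mittagLeffler γ 1 (-(y * t ^ γ))) s =
          Real.Gamma (1 - γ) * (-x * mittagLeffler γ 1 (-(x * t ^ γ))) -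
          Real.Gamma (1 - γ) * (-y * mittagLeffler γ 1 (-(y * t ^ γ))) := by
        rw [← integral_kernel_mul_deriv_mittagLeffler' hγ0 hγ1 x ht.1,
          ← integral_kernel_mul_deriv_mittagLeffler' hγ0 hγ1 y ht.1,
          ← intervalIntegral.integral_sub
            ((intervalIntegrable_iff_integrableOn_Ioo_of_le ht.1.le).mpr
              (integrableOn_kernel_mul_deriv_mittagLeffler hγ0 hγ1 x ht.1))
            ((intervalIntegrable_iff_integrableOn_Ioo_of_le ht.1.le).mpr
              (integrableOn_kernel_mul_deriv_mittagLeffler hγ0 hγ1 y ht.1)),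
          intervalIntegral.integral_of_le ht.1.le, intervalIntegral.integral_of_le ht.1.le]
        refine setIntegral_congr_fun measurableSet_Ioc fun s hs => ?_
        rw [hderiv s hs.1]
        ring
      rw [hI, ← mul_sub]
      have h2 : 0 ≤ mittagLeffler γ 1 (-(y * t ^ γ)) :=
        mittagLeffler_neg_nonneg hγ0 hγ1 (mul_nonneg hy (Real.rpow_nonneg ht.1.le _))
      refine mul_nonneg hG.le ?_
      nlinarith [mul_nonneg (sub_nonneg.mpr hxy) h2])
    (t := 1) ⟨one_pos, one_lt_two⟩
  simpa using h

lemma mittagLeffler_neg_le_one {γ : ℝ} (hγ0 : 0 < γ) (hγ1 : γ < 1) {x : ℝ} (hx : 0 ≤ x) :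
    mittagLeffler γ 1 (-x) ≤ 1 := by
  have h := antitoneOn_mittagLeffler_neg hγ0 hγ1 self_mem_Ici (mem_Ici.mpr hx) hx
  simpa [mittagLeffler_zero] using h

/-- The extremum principle at `t = 1`, where the decreasing function `E_{γ,1}(-x t ^ γ)` has its
minimum over `[0, 1]`. -/
lemma le_mittagLeffler_neg {γ : ℝ} (hγ0 : 0 < γ) (hγ1 : γ < 1) {x : ℝ} (hx : 0 ≤ x) :
    1 / (1 + Real.Gamma (1 - γ) * x) ≤ mittagLeffler γ 1 (-x) := by
  have hG := Real.Gamma_pos_of_pos (sub_pos.mpr hγ1)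
  have h := integral_sub_rpow_mul_deriv_le_of_isMin hγ0 hγ1 one_pos
    (continuous_mittagLeffler_rpow hγ0 one_pos hγ0 x).continuousOn
    (fun t ht => (hasDerivAt_mittagLeffler_rpow hγ0 x ht.1).differentiableAt.differentiableWithinAt)
    (hasDerivAt_mittagLeffler_rpow hγ0 x one_pos).differentiableAt
    (integrableOn_kernel_mul_deriv_mittagLeffler hγ0 hγ1 x one_pos)
    (fun s hs => by
      have h1 : s ^ γ ≤ 1 := Real.rpow_le_one hs.1 hs.2 hγ0.le
      have h2 : 0 ≤ s ^ γ := Real.rpow_nonneg hs.1 _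
      refine antitoneOn_mittagLeffler_neg hγ0 hγ1 (mem_Ici.mpr (by positivity))
        (mem_Ici.mpr (by simpa using hx)) ?_
      rw [Real.one_rpow]
      gcongr)
  rw [integral_kernel_mul_deriv_mittagLeffler' hγ0 hγ1 x one_pos] at h
  simp only [Real.one_rpow, mul_one, one_mul, Real.zero_rpow hγ0.ne', mul_zero, neg_zero,
    mittagLeffler_zero, Real.Gamma_one, div_one] at h
  rw [div_le_iff₀ (by positivity)]
  linarith

lemma mittagLeffler_neg_pos {γ : ℝ} (hγ0 : 0 < γ) (hγ1 : γ < 1) {x : ℝ} (hx : 0 ≤ x) :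
    0 < mittagLeffler γ 1 (-x) := by
  have hG := Real.Gamma_pos_of_pos (sub_pos.mpr hγ1)
  exact lt_of_lt_of_le (by positivity) (le_mittagLeffler_neg hγ0 hγ1 hx)

/-- By the Volterra equation, `1 - E_{γ,1}(-x)` is `x` times the fractional integral of order `γ`
of the relaxation function, which on `[0, 1]` is at least `E_{γ,1}(-x)`. -/
lemma mittagLeffler_neg_le {γ : ℝ} (hγ0 : 0 < γ) (hγ1 : γ < 1) {x : ℝ} (hx : 0 ≤ x) :
    mittagLeffler γ 1 (-x) ≤ 1 / (1 + x / Real.Gamma (1 + γ)) := by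
  have hG := Real.Gamma_pos_of_pos hγ0
  have hG1 := Real.Gamma_pos_of_pos (add_pos one_pos hγ0)
  have h1 := mittagLeffler_eq_add hγ0 one_pos (-x)
  have h2 := integral_sub_rpow_mul_mittagLeffler hγ0 one_pos hγ0 one_pos x
  have h3 := integral_sub_rpow_mul_rpow one_pos hγ0 one_pos
  have h4 : ∫ s in (0 : ℝ)..1, ((1 - s) ^ (γ - 1) * s ^ ((1 : ℝ) - 1)) * mittagLeffler γ 1 (-x) ≤
      ∫ s in (0 : ℝ)..1, (1 - s) ^ (γ - 1) *
        (s ^ ((1 : ℝ) - 1) * mittagLeffler γ 1 (-(x * s ^ γ))) := by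
    refine intervalIntegral.integral_mono_on zero_le_one
      ((intervalIntegrable_sub_rpow_mul_rpow one_pos hγ0 one_pos).mul_const _) ?_ fun s hs => ?_
    · have := (intervalIntegrable_sub_rpow_mul_rpow one_pos hγ0 one_pos).mul_continuousOn
        (continuous_mittagLeffler_rpow hγ0 one_pos hγ0 x).continuousOn
      simpa only [mul_assoc] using this
    · have h1 : s ^ γ ≤ 1 := Real.rpow_le_one hs.1 hs.2 hγ0.le
      have h2 : 0 ≤ s ^ γ := Real.rpow_nonneg hs.1 _
      have h3 : mittagLeffler γ 1 (-x) ≤ mittagLeffler γ 1 (-(x * s ^ γ)) :=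
        antitoneOn_mittagLeffler_neg hγ0 hγ1 (mem_Ici.mpr (by positivity)) (mem_Ici.mpr hx)
          (mul_le_of_le_one_right hx h1)
      have h4 : 0 ≤ 1 - s := by linarith [hs.2]
      have h5 := hs.1
      rw [mul_assoc]
      gcongr
  rw [intervalIntegral.integral_mul_const, h3, h2] at h4
  simp only [Real.one_rpow, one_mul, mul_one, Real.Gamma_one] at h4 h1
  have h5 : mittagLeffler γ 1 (-x) / Real.Gamma (1 + γ) ≤ mittagLeffler γ (1 + γ) (-x) := by
    rw [div_mul_eq_mul_div, mul_div_assoc] at h4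
    exact le_of_mul_le_mul_left h4 hG
  rw [le_div_iff₀ (by positivity)]
  have h6 : x * (mittagLeffler γ 1 (-x) / Real.Gamma (1 + γ)) ≤
      x * mittagLeffler γ (1 + γ) (-x) := by gcongr
  calc mittagLeffler γ 1 (-x) * (1 + x / Real.Gamma (1 + γ))
      = mittagLeffler γ 1 (-x) + x * (mittagLeffler γ 1 (-x) / Real.Gamma (1 + γ)) := by ring
    _ ≤ 1 := by linarith

lemma mittagLeffler_self_neg_nonneg {γ : ℝ} (hγ0 : 0 < γ) (hγ1 : γ < 1) {x : ℝ} (hx : 0 ≤ x) :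
    0 ≤ mittagLeffler γ γ (-x) := by
  have h1 : HasDerivAt (fun x => mittagLeffler γ 1 (-x)) (-(γ⁻¹ * mittagLeffler γ γ (-x))) x := by
    refine ((hasDerivAt_mittagLeffler hγ0 (-x)).comp x (hasDerivAt_neg x)).congr_deriv ?_
    ring
  have h2 := (antitoneOn_mittagLeffler_neg hγ0 hγ1).derivWithin_nonpos (x := x)
  rw [h1.hasDerivWithinAt.derivWithin (uniqueDiffOn_Ici 0 x hx)] at h2
  have h3 : 0 ≤ γ⁻¹ * mittagLeffler γ γ (-x) := by linarith
  exact nonneg_of_mul_nonneg_right h3 (inv_pos.mpr hγ0)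

lemma mittagLeffler_self_neg_le {γ : ℝ} (hγ0 : 0 < γ) (hγ1 : γ < 1) {x : ℝ} (hx : 0 ≤ x) :
    mittagLeffler γ γ (-x) ≤ 1 / Real.Gamma γ := by
  have hG := Real.Gamma_pos_of_pos hγ0
  have h1 := mittagLeffler_eq_add hγ0 hγ0 (-x)
  have h2 := integral_sub_rpow_mul_mittagLeffler hγ0 hγ0 hγ0 one_pos x
  have h3 : 0 ≤ ∫ s in (0 : ℝ)..1, (1 - s) ^ (γ - 1) *
      (s ^ (γ - 1) * mittagLeffler γ γ (-(x * s ^ γ))) := by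
    refine intervalIntegral.integral_nonneg zero_le_one fun s hs => ?_
    have h4 : 0 ≤ 1 - s := by linarith [hs.2]
    have h5 := hs.1
    have := mittagLeffler_self_neg_nonneg hγ0 hγ1
      (mul_nonneg hx (Real.rpow_nonneg hs.1 γ))
    positivity
  rw [h2] at h3
  simp only [Real.one_rpow, mul_one, one_mul] at h3
  have h4 : 0 ≤ mittagLeffler γ (γ + γ) (-x) := nonneg_of_mul_nonneg_right h3 hG
  nlinarith [mul_nonneg hx h4]

lemma norm_mittagLeffler_self_neg_le {γ : ℝ} (hγ0 : 0 < γ) (hγ1 : γ < 1) {x : ℝ} (hx : 0 ≤ x) :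
    ‖mittagLeffler γ γ (-x)‖ ≤ 1 / Real.Gamma γ := by
  rw [Real.norm_of_nonneg (mittagLeffler_self_neg_nonneg hγ0 hγ1 hx)]
  exact mittagLeffler_self_neg_le hγ0 hγ1 hx

/-! ### Fourier multipliers on `L²(ℝ)` -/

lemma L2R.norm_sq_eq_integral (f : L2R) : ‖f‖ ^ 2 = ∫ x, ‖f x‖ ^ 2 := by
  have h := inner_self_eq_norm_sq_to_K (𝕜 := ℂ) f
  rw [L2.inner_def] at h
  have h2 : ∫ x, inner ℂ (f x) (f x) = ((∫ x, ‖f x‖ ^ 2 : ℝ) : ℂ) := by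
    rw [← integral_complex_ofReal]
    congr 1
    ext x
    rw [inner_self_eq_norm_sq_to_K]
    push_cast
    rfl
  rw [h2] at h
  apply Complex.ofReal_injective
  rw [h]
  push_cast
  rfl

lemma L2R.integrable_norm_sq (f : L2R) : Integrable fun x => ‖f x‖ ^ 2 :=
  (memLp_two_iff_integrable_sq_norm (Lp.aestronglyMeasurable f)).mp (Lp.memLp f)

lemma memLp_top_ofReal {m : ℝ → ℝ} (hm : Measurable m) {C : ℝ} (hC : ∀ ξ, |m ξ| ≤ C) :
    MemLp (fun ξ => (m ξ : ℂ)) ∞ (volume : Measure ℝ) :=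
  memLp_top_of_bound (by fun_prop) C (Filter.Eventually.of_forall fun ξ => by simpa using hC ξ)

/-- The Fourier multiplier on `L²(ℝ)` whose symbol is the essentially bounded real function `m`. -/
noncomputable def fourierMul (m : ℝ → ℝ) (hm : MemLp (fun ξ => (m ξ : ℂ)) ∞ (volume : Measure ℝ)) :
    L2R →L[ℂ] L2R :=
  ((Lp.fourierTransformₗᵢ ℝ ℂ).symm.toContinuousLinearEquiv : L2R →L[ℂ] L2R) ∘L
    ((ContinuousLinearMap.mul ℂ ℂ).holderL volume ∞ 2 2 hm.toLp) ∘L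
    ((Lp.fourierTransformₗᵢ ℝ ℂ).toContinuousLinearEquiv : L2R →L[ℂ] L2R)

lemma fourier_fourierMul {m : ℝ → ℝ} (hm : MemLp (fun ξ => (m ξ : ℂ)) ∞ (volume : Measure ℝ))
    (f : L2R) :
    ((𝓕 (fourierMul m hm f) : L2R) : ℝ → ℂ) =ᵐ[volume] fun ξ => (m ξ : ℂ) * (𝓕 f : L2R) ξ := by
  have h : (𝓕 (fourierMul m hm f) : L2R) =
      (ContinuousLinearMap.mul ℂ ℂ).holder 2 hm.toLp (𝓕 f : L2R) :=
    (Lp.fourierTransformₗᵢ ℝ ℂ).apply_symm_apply _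
  rw [h]
  filter_upwards [(ContinuousLinearMap.mul ℂ ℂ).coeFn_holder (r := 2) hm.toLp (𝓕 f : L2R),
    hm.coeFn_toLp] with ξ h1 h2
  rw [h1, h2]
  rfl

lemma L2R.ext_fourier {f g : L2R} (h : ((𝓕 f : L2R) : ℝ → ℂ) =ᵐ[volume] (𝓕 g : L2R)) : f = g :=
  (Lp.fourierTransformₗᵢ ℝ ℂ).injective (Lp.ext h)

lemma L2R.inner_eq_integral_fourier (f g : L2R) :
    inner ℂ f g = ∫ ξ, starRingEnd ℂ ((𝓕 f : L2R) ξ) * (𝓕 g : L2R) ξ := by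
  rw [← Lp.inner_fourier_eq f g, L2.inner_def]
  congr 1
  ext ξ
  rw [RCLike.inner_apply, mul_comm]

lemma inner_fourierMul_left {m : ℝ → ℝ} (hm : MemLp (fun ξ => (m ξ : ℂ)) ∞ (volume : Measure ℝ))
    (f g : L2R) : inner ℂ (fourierMul m hm f) g = inner ℂ f (fourierMul m hm g) := by
  rw [L2R.inner_eq_integral_fourier, L2R.inner_eq_integral_fourier]
  refine integral_congr_ae ?_
  filter_upwards [fourier_fourierMul hm f, fourier_fourierMul hm g] with ξ h1 h2
  rw [h1, h2, map_mul, Complex.conj_ofReal]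
  ring

lemma adjoint_fourierMul {m : ℝ → ℝ} (hm : MemLp (fun ξ => (m ξ : ℂ)) ∞ (volume : Measure ℝ)) :
    ContinuousLinearMap.adjoint (fourierMul m hm) = fourierMul m hm := by
  symm
  rw [ContinuousLinearMap.eq_adjoint_iff]
  exact inner_fourierMul_left hm

lemma ker_fourierMul {m : ℝ → ℝ} (hm : MemLp (fun ξ => (m ξ : ℂ)) ∞ (volume : Measure ℝ))
    (h0 : ∀ ξ, m ξ ≠ 0) : LinearMap.ker (fourierMul m hm : L2R →ₗ[ℂ] L2R) = ⊥ := by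
  rw [LinearMap.ker_eq_bot']
  intro f hf
  refine L2R.ext_fourier ?_
  have hf' : fourierMul m hm f = fourierMul m hm 0 := by rw [map_zero]; exact hf
  filter_upwards [fourier_fourierMul hm f, fourier_fourierMul hm 0] with ξ h1 h2
  rw [hf', h2] at h1
  exact (mul_left_cancel₀ (Complex.ofReal_ne_zero.mpr (h0 ξ)) h1).symm

/-- Dominated convergence in the frequency domain: pointwise convergent symbols bounded by `1`
give convergence in `L²`. -/
lemma tendsto_L2R_of_symbol {ι : Type*} {l : Filter ι} [l.IsCountablyGenerated]
    {U : ι → L2R} {V F : L2R} {m : ι → ℝ → ℝ} {m₀ : ℝ → ℝ}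
    (hm : ∀ᶠ i in l, ∀ ξ, |m i ξ| ≤ 1) (hm₀ : ∀ ξ, |m₀ ξ| ≤ 1)
    (hU : ∀ᶠ i in l, ((𝓕 (U i) : L2R) : ℝ → ℂ) =ᵐ[volume] fun ξ => (m i ξ : ℂ) * F ξ)
    (hV : ((𝓕 V : L2R) : ℝ → ℂ) =ᵐ[volume] fun ξ => (m₀ ξ : ℂ) * F ξ)
    (hlim : ∀ ξ, Filter.Tendsto (fun i => m i ξ) l (nhds (m₀ ξ))) :
    Filter.Tendsto U l (nhds V) := by
  rw [tendsto_iff_norm_sub_tendsto_zero]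
  have hsq : Filter.Tendsto (fun i => ‖U i - V‖ ^ 2) l (nhds 0) := by
    have hae : ∀ᶠ i in l, (fun ξ => ‖(𝓕 (U i - V) : L2R) ξ‖ ^ 2) =ᵐ[volume]
        fun ξ => (m i ξ - m₀ ξ) ^ 2 * ‖F ξ‖ ^ 2 := by
      filter_upwards [hU] with i hi
      have hs : (𝓕 (U i - V) : L2R) = 𝓕 (U i) - 𝓕 V := (Lp.fourierTransformₗᵢ ℝ ℂ).map_sub _ _
      rw [hs]
      filter_upwards [hi, hV, Lp.coeFn_sub (𝓕 (U i) : L2R) (𝓕 V)] with ξ h1 h2 h3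
      rw [h3, Pi.sub_apply, h1, h2, ← sub_mul, ← Complex.ofReal_sub, norm_mul, mul_pow,
        Complex.norm_real, Real.norm_eq_abs, sq_abs]
    have heq : ∀ᶠ i in l, ∫ ξ, (m i ξ - m₀ ξ) ^ 2 * ‖F ξ‖ ^ 2 = ‖U i - V‖ ^ 2 := by
      filter_upwards [hae] with i hi
      rw [← integral_congr_ae hi, ← L2R.norm_sq_eq_integral, Lp.norm_fourier_eq]
    refine Filter.Tendsto.congr' heq ?_
    have h0 : (0 : ℝ) = ∫ ξ : ℝ, (m₀ ξ - m₀ ξ) ^ 2 * ‖F ξ‖ ^ 2 := by simp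
    rw [h0]
    refine tendsto_integral_filter_of_dominated_convergence (fun ξ => 4 * ‖F ξ‖ ^ 2) ?_ ?_
      ((L2R.integrable_norm_sq F).const_mul 4)
      (Filter.Eventually.of_forall fun ξ => (((hlim ξ).sub_const _).pow 2).mul_const _)
    · filter_upwards [hae] with i hi
      exact (L2R.integrable_norm_sq _).aestronglyMeasurable.congr hi
    · filter_upwards [hm] with i hmi
      refine Filter.Eventually.of_forall fun ξ => ?_
      rw [norm_mul, norm_pow, norm_pow, norm_norm, Real.norm_eq_abs, sq_abs]
      have h2 := abs_le.mp (hmi ξ)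
      have h3 := abs_le.mp (hm₀ ξ)
      have h4 : (m i ξ - m₀ ξ) ^ 2 ≤ 4 := by nlinarith
      gcongr
  have := hsq.sqrt
  simpa using this

/-! ### Pairings with Schwartz functions in the frequency domain -/

lemma L2R.integrable_mul_schwartz (F : L2R) (χ : 𝓢(ℝ, ℂ)) : Integrable fun ξ => F ξ * χ ξ :=
  (Lp.memLp F).integrable_mul (χ.memLp 2)

lemma pairing_eq_integral_fourier (f : L2R) (φ : 𝓢(ℝ, ℂ)) :
    pairing f φ = ∫ ξ, (𝓕 f : L2R) ξ * (𝓕⁻ φ) ξ := by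
  have h := congrArg (fun Φ : 𝓢'(ℝ, ℂ) => Φ (𝓕⁻ φ)) (Lp.fourier_toTemperedDistribution_eq f)
  simp only [TemperedDistribution.fourier_apply, FourierTransform.fourier_fourierInv_eq,
    Lp.toTemperedDistribution_apply, smul_eq_mul] at h
  rw [pairing]
  simpa only [mul_comm] using h

lemma fourierInv_laplacian_apply (φ : 𝓢(ℝ, ℂ)) (ξ : ℝ) :
    (𝓕⁻ (Δ φ)) ξ = -((|2 * Real.pi * ξ| ^ 2 : ℝ) : ℂ) * (𝓕⁻ φ) ξ := by
  have hneg : ∀ (χ : 𝓢(ℝ, ℂ)), (𝓕⁻ χ) ξ = (𝓕 χ) (-ξ) := fun χ => rfl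
  rw [hneg, hneg, SchwartzMap.laplacian_eq_fourierMultiplierCLM,
    SchwartzMap.fourierMultiplierCLM_apply, FourierTransform.fourier_smul,
    FourierTransform.fourier_fourierInv_eq, smul_apply,
    SchwartzMap.smulLeftCLM_apply_apply (by fun_prop), sq_abs]
  simp
  ring

lemma pairing_laplacian (f : L2R) (φ : 𝓢(ℝ, ℂ)) :
    pairing f (Δ φ) =
      ∫ ξ, -((|2 * Real.pi * ξ| ^ 2 : ℝ) : ℂ) * ((𝓕 f : L2R) ξ * (𝓕⁻ φ) ξ) := by
  rw [pairing_eq_integral_fourier]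
  congr 1
  ext ξ
  rw [fourierInv_laplacian_apply]
  ring

lemma norm_pairing_le (f : L2R) (φ : 𝓢(ℝ, ℂ)) : ‖pairing f φ‖ ≤ ‖f‖ * ‖(𝓕⁻ φ).toLp 2‖ := by
  have h : pairing f φ = inner ℂ (star (𝓕 f : L2R)) ((𝓕⁻ φ).toLp 2) := by
    rw [pairing_eq_integral_fourier, L2.inner_def]
    refine integral_congr_ae ?_
    filter_upwards [(𝓕⁻ φ).coeFn_toLp 2, Lp.coeFn_star (𝓕 f : L2R)] with ξ h1 h2
    rw [h1, h2, RCLike.inner_apply, Pi.star_apply, RCLike.star_def, RCLike.conj_conj, mul_comm]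
  rw [h]
  refine (norm_inner_le_norm _ _).trans ?_
  have h1 : ‖star (𝓕 f : L2R)‖ = ‖(𝓕 f : L2R)‖ := by
    rw [Lp.norm_def, Lp.norm_def]
    congr 1
    refine eLpNorm_congr_norm_ae ?_
    filter_upwards [Lp.coeFn_star (𝓕 f : L2R)] with ξ h2
    rw [h2, Pi.star_apply, norm_star]
  rw [h1, Lp.norm_fourier_eq]

lemma L2R.eq_zero_of_pairing (f : L2R)
    (h : ∀ φ : 𝓢(ℝ, ℂ), HasCompactSupport (𝓕⁻ φ : 𝓢(ℝ, ℂ)) → pairing f φ = 0) : f = 0 := by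
  have h0 : (𝓕 (0 : L2R) : L2R) = 0 := (Lp.fourierTransformₗᵢ ℝ ℂ).map_zero
  refine L2R.ext_fourier ?_
  rw [h0]
  refine Filter.EventuallyEq.trans ?_ (Lp.coeFn_zero ℂ 2 volume).symm
  refine ae_eq_zero_of_integral_contDiff_smul_eq_zero
    ((Lp.memLp (𝓕 f : L2R)).locallyIntegrable (by norm_num)) fun g hg hgs => ?_
  have hg₁ : HasCompactSupport (Complex.ofRealCLM ∘ g) := hgs.comp_left rfl
  have hg₂ : ContDiff ℝ (⊤ : ℕ∞) (Complex.ofRealCLM ∘ g) := by fun_prop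
  have h1 := h (𝓕 (hg₁.toSchwartzMap hg₂)) (by
    rw [FourierTransform.fourierInv_fourier_eq]
    exact hg₁)
  rw [pairing_eq_integral_fourier, FourierTransform.fourierInv_fourier_eq] at h1
  rw [← h1]
  congr 1
  ext ξ
  simp [mul_comm]

/-! ### Superpositions of relaxation functions -/

section Superposition

variable {γ : ℝ} {lam : ℝ → ℝ} {G : ℝ → ℂ}

lemma norm_deriv_symbol_mul_le (hγ0 : 0 < γ) (hγ1 : γ < 1) {x t : ℝ} (hx : 0 ≤ x) (ht : 0 < t)
    (z : ℂ) :
    ‖((-x * (t ^ (γ - 1) * mittagLeffler γ γ (-(x * t ^ γ))) : ℝ) : ℂ) * z‖ ≤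
      t ^ (γ - 1) / Real.Gamma γ * ‖(x : ℂ) * z‖ := by
  have hG := Real.Gamma_pos_of_pos hγ0
  have hE := norm_mittagLeffler_self_neg_le hγ0 hγ1 (mul_nonneg hx (Real.rpow_nonneg ht.le γ))
  rw [norm_mul, norm_mul, Complex.norm_real, Complex.norm_real, norm_mul, norm_mul, norm_neg,
    Real.norm_of_nonneg (Real.rpow_nonneg ht.le (γ - 1))]
  calc ‖x‖ * (t ^ (γ - 1) * ‖mittagLeffler γ γ (-(x * t ^ γ))‖) * ‖z‖
      ≤ ‖x‖ * (t ^ (γ - 1) * (1 / Real.Gamma γ)) * ‖z‖ := by gcongr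
    _ = t ^ (γ - 1) / Real.Gamma γ * (‖x‖ * ‖z‖) := by ring

lemma integrable_symbol_mul (hγ0 : 0 < γ) (hγ1 : γ < 1) (hlam : Measurable lam)
    (hlam0 : ∀ ξ, 0 ≤ lam ξ) (hG : Integrable G) {t : ℝ} (ht : 0 ≤ t) :
    Integrable fun ξ => ((mittagLeffler γ 1 (-(lam ξ * t ^ γ)) : ℝ) : ℂ) * G ξ := by
  refine hG.bdd_mul (c := 1) ?_ (Filter.Eventually.of_forall fun ξ => ?_)
  · have := (continuous_mittagLeffler hγ0 one_pos).measurable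
    exact (Complex.measurable_ofReal.comp
      (this.comp (hlam.mul_const _).neg)).aestronglyMeasurable
  · have hx := mul_nonneg (hlam0 ξ) (Real.rpow_nonneg ht γ)
    rw [Complex.norm_real, Real.norm_of_nonneg (mittagLeffler_neg_nonneg hγ0 hγ1 hx)]
    exact mittagLeffler_neg_le_one hγ0 hγ1 hx

lemma hasDerivAt_integral_symbol_mul (hγ0 : 0 < γ) (hγ1 : γ < 1) (hlam : Measurable lam)
    (hlam0 : ∀ ξ, 0 ≤ lam ξ) (hG : Integrable G) (hlG : Integrable fun ξ => (lam ξ : ℂ) * G ξ)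
    {t : ℝ} (ht : 0 < t) :
    HasDerivAt (fun t => ∫ ξ, ((mittagLeffler γ 1 (-(lam ξ * t ^ γ)) : ℝ) : ℂ) * G ξ)
      (∫ ξ, ((-lam ξ * (t ^ (γ - 1) * mittagLeffler γ γ (-(lam ξ * t ^ γ))) : ℝ) : ℂ) * G ξ)
      t := by
  have hGam := Real.Gamma_pos_of_pos hγ0
  have hm := (continuous_mittagLeffler hγ0 hγ0).measurable
  refine (hasDerivAt_integral_of_dominated_loc_of_deriv_le (s := Ioi (t / 2))
    (F' := fun r ξ =>
      ((-lam ξ * (r ^ (γ - 1) * mittagLeffler γ γ (-(lam ξ * r ^ γ))) : ℝ) : ℂ) * G ξ)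
    (bound := fun ξ => (t / 2) ^ (γ - 1) / Real.Gamma γ * ‖(lam ξ : ℂ) * G ξ‖)
    (Ioi_mem_nhds (by linarith)) ?_ (integrable_symbol_mul hγ0 hγ1 hlam hlam0 hG ht.le) ?_ ?_
    (hlG.norm.const_mul _) ?_).2
  · filter_upwards [Ioi_mem_nhds ht] with r hr
    exact (integrable_symbol_mul hγ0 hγ1 hlam hlam0 hG (le_of_lt hr)).aestronglyMeasurable
  · refine AEStronglyMeasurable.mul ?_ hG.aestronglyMeasurable
    exact (Complex.measurable_ofReal.comp (hlam.neg.mul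
      ((hm.comp (hlam.mul_const _).neg).const_mul _))).aestronglyMeasurable
  · refine Filter.Eventually.of_forall fun ξ r hr => ?_
    have hr : t / 2 < r := hr
    refine (norm_deriv_symbol_mul_le hγ0 hγ1 (hlam0 ξ) (by linarith) _).trans ?_
    have : r ^ (γ - 1) ≤ (t / 2) ^ (γ - 1) :=
      Real.rpow_le_rpow_of_nonpos (by linarith) hr.le (by linarith)
    gcongr
  · refine Filter.Eventually.of_forall fun ξ r hr => ?_
    have hr : t / 2 < r := hr
    exact ((hasDerivAt_mittagLeffler_rpow hγ0 (lam ξ)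
      (by linarith : (0 : ℝ) < r)).ofReal_comp).mul_const _

lemma norm_integral_deriv_symbol_mul_le (hγ0 : 0 < γ) (hγ1 : γ < 1) (hlam0 : ∀ ξ, 0 ≤ lam ξ)
    (hlG : Integrable fun ξ => (lam ξ : ℂ) * G ξ) {t : ℝ} (ht : 0 < t) :
    ‖∫ ξ, ((-lam ξ * (t ^ (γ - 1) * mittagLeffler γ γ (-(lam ξ * t ^ γ))) : ℝ) : ℂ) * G ξ‖ ≤
      t ^ (γ - 1) / Real.Gamma γ * ∫ ξ, ‖(lam ξ : ℂ) * G ξ‖ := by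
  rw [← integral_const_mul]
  exact norm_integral_le_of_norm_le (hlG.norm.const_mul _)
    (Filter.Eventually.of_forall fun ξ => norm_deriv_symbol_mul_le hγ0 hγ1 (hlam0 ξ) ht _)

/-- The Caputo integral of a superposition, by Fubini's theorem. -/
lemma integral_kernel_mul_integral_deriv_symbol_mul (hγ0 : 0 < γ) (hγ1 : γ < 1)
    (hlam : Measurable lam) (hlam0 : ∀ ξ, 0 ≤ lam ξ) (hG : Integrable G)
    (hlG : Integrable fun ξ => (lam ξ : ℂ) * G ξ) {t : ℝ} (ht : 0 < t) :
    ∫ s in (0 : ℝ)..t, (((t - s) ^ (-γ) : ℝ) : ℂ) *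
      ∫ ξ, ((-lam ξ * (s ^ (γ - 1) * mittagLeffler γ γ (-(lam ξ * s ^ γ))) : ℝ) : ℂ) * G ξ =
    (Real.Gamma (1 - γ) : ℂ) *
      ∫ ξ, -(lam ξ : ℂ) * (((mittagLeffler γ 1 (-(lam ξ * t ^ γ)) : ℝ) : ℂ) * G ξ) := by
  have hm := (continuous_mittagLeffler hγ0 hγ0).measurable
  set f : ℝ → ℝ → ℂ := fun s ξ => (((t - s) ^ (-γ) : ℝ) : ℂ) *
    (((-lam ξ * (s ^ (γ - 1) * mittagLeffler γ γ (-(lam ξ * s ^ γ))) : ℝ) : ℂ) * G ξ) with hf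
  have hint : Integrable (Function.uncurry f) ((volume.restrict (Ioc 0 t)).prod volume) := by
    have hk : Integrable (fun s => (t - s) ^ (-γ) * s ^ (γ - 1)) (volume.restrict (Ioc 0 t)) := by
      have := (intervalIntegrable_sub_rpow_mul_rpow hγ0 (sub_pos.mpr hγ1) ht).1
      rwa [show 1 - γ - 1 = -γ by ring] at this
    refine (hk.mul_prod (hlG.norm.const_mul (1 / Real.Gamma γ))).mono' ?_ ?_
    · have h1 : Measurable fun p : ℝ × ℝ => (t - p.1) ^ (-γ) := by fun_prop
      have h2 : Measurable fun p : ℝ × ℝ =>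
          -lam p.2 * (p.1 ^ (γ - 1) * mittagLeffler γ γ (-(lam p.2 * p.1 ^ γ))) := by
        have h3 : Measurable fun p : ℝ × ℝ => -(lam p.2 * p.1 ^ γ) := by fun_prop
        have h4 : Measurable fun p : ℝ × ℝ => p.1 ^ (γ - 1) := by fun_prop
        exact (hlam.comp measurable_snd).neg.mul (h4.mul (hm.comp h3))
      exact (Complex.measurable_ofReal.comp h1).aestronglyMeasurable.mul
        ((Complex.measurable_ofReal.comp h2).aestronglyMeasurable.mul
          hG.aestronglyMeasurable.comp_snd)
    · filter_upwards [Measure.quasiMeasurePreserving_fst.ae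
        (ae_restrict_mem (μ := volume) (measurableSet_Ioc (a := (0 : ℝ)) (b := t)))] with p hp
      have h1 : 0 ≤ t - p.1 := by linarith [hp.2]
      simp only [Function.uncurry, hf]
      rw [norm_mul, Complex.norm_real, Real.norm_of_nonneg (Real.rpow_nonneg h1 _), mul_assoc]
      refine mul_le_mul_of_nonneg_left ?_ (Real.rpow_nonneg h1 _)
      refine (norm_deriv_symbol_mul_le hγ0 hγ1 (hlam0 p.2) hp.1 _).trans (le_of_eq ?_)
      ring
  have hswap := integral_integral_swap hint
  rw [intervalIntegral.integral_of_le ht.le, ← integral_const_mul]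
  simp only [← integral_const_mul]
  refine hswap.trans ?_
  congr 1
  ext ξ
  have h1 := integral_kernel_mul_deriv_mittagLeffler hγ0 hγ1 (lam ξ) ht
  have h2 : ∫ s in Ioc 0 t, f s ξ = ((∫ s in (0 : ℝ)..t, (t - s) ^ (-γ) *
      (-lam ξ * (s ^ (γ - 1) * mittagLeffler γ γ (-(lam ξ * s ^ γ)))) : ℝ) : ℂ) * G ξ := by
    rw [intervalIntegral.integral_of_le ht.le, ← integral_complex_ofReal, ← integral_mul_const]
    congr 1
    ext s
    simp only [hf]
    push_cast
    ring
  rw [h2, h1]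
  push_cast
  ring

end Superposition

/-! ### Existence for the fractional heat equation -/

lemma measurable_fracSymbol {γ : ℝ} (hγ0 : 0 < γ) (T : ℝ) : Measurable (fracSymbol γ T) := by
  have h := (continuous_mittagLeffler hγ0 one_pos).measurable
  have h2 : Measurable fun ξ : ℝ => -(|2 * Real.pi * ξ| ^ 2 * T ^ γ) := by fun_prop
  exact h.comp h2

lemma fracSymbol_arg_nonneg {T : ℝ} (γ : ℝ) (hT : 0 ≤ T) (ξ : ℝ) :
    0 ≤ |2 * Real.pi * ξ| ^ 2 * T ^ γ := mul_nonneg (by positivity) (Real.rpow_nonneg hT γ)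

lemma fracSymbol_pos {γ T : ℝ} (hγ0 : 0 < γ) (hγ1 : γ < 1) (hT : 0 ≤ T) (ξ : ℝ) :
    0 < fracSymbol γ T ξ := mittagLeffler_neg_pos hγ0 hγ1 (fracSymbol_arg_nonneg γ hT ξ)

lemma abs_fracSymbol_le_one {γ T : ℝ} (hγ0 : 0 < γ) (hγ1 : γ < 1) (hT : 0 ≤ T) (ξ : ℝ) :
    |fracSymbol γ T ξ| ≤ 1 := by
  rw [abs_of_pos (fracSymbol_pos hγ0 hγ1 hT ξ)]
  exact mittagLeffler_neg_le_one hγ0 hγ1 (fracSymbol_arg_nonneg γ hT ξ)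

lemma memLp_fracSymbol {γ T : ℝ} (hγ0 : 0 < γ) (hγ1 : γ < 1) (hT : 0 ≤ T) :
    MemLp (fun ξ => (fracSymbol γ T ξ : ℂ)) ∞ (volume : Measure ℝ) :=
  memLp_top_ofReal (measurable_fracSymbol hγ0 T) (abs_fracSymbol_le_one hγ0 hγ1 hT)

/-- The solution operator at time `t` of the fractional heat equation: the Fourier multiplier with
symbol `E_{γ,1}(-|ω|² t ^ γ)`. -/
noncomputable def fracHeat {γ : ℝ} (hγ0 : 0 < γ) (hγ1 : γ < 1) {t : ℝ} (ht : 0 ≤ t) :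
    L2R →L[ℂ] L2R :=
  fourierMul (fracSymbol γ t) (memLp_fracSymbol hγ0 hγ1 ht)

lemma fourier_fracHeat {γ t : ℝ} (hγ0 : 0 < γ) (hγ1 : γ < 1) (ht : 0 ≤ t) (f : L2R) :
    ((𝓕 (fracHeat hγ0 hγ1 ht f) : L2R) : ℝ → ℂ) =ᵐ[volume]
      fun ξ => (fracSymbol γ t ξ : ℂ) * (𝓕 f : L2R) ξ :=
  fourier_fourierMul _ f

lemma pairing_fracHeat {γ t : ℝ} (hγ0 : 0 < γ) (hγ1 : γ < 1) (ht : 0 ≤ t) (f : L2R)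
    (φ : 𝓢(ℝ, ℂ)) :
    pairing (fracHeat hγ0 hγ1 ht f) φ = ∫ ξ,
      ((mittagLeffler γ 1 (-(|2 * Real.pi * ξ| ^ 2 * t ^ γ)) : ℝ) : ℂ) *
        ((𝓕 f : L2R) ξ * (𝓕⁻ φ) ξ) := by
  rw [pairing_eq_integral_fourier]
  refine integral_congr_ae ?_
  filter_upwards [fourier_fracHeat hγ0 hγ1 ht f] with ξ h
  rw [h, mul_assoc]
  rfl

lemma isFracHeatSolution_fracHeat {γ T : ℝ} (hγ0 : 0 < γ) (hγ1 : γ < 1) (θ₀ : L2R) :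
    IsFracHeatSolution γ T θ₀ fun t => fracHeat hγ0 hγ1 (abs_nonneg t) θ₀ := by
  set lam : ℝ → ℝ := fun ξ => |2 * Real.pi * ξ| ^ 2 with hlamdef
  have hlam : Measurable lam := by fun_prop
  have hlam0 : ∀ ξ, 0 ≤ lam ξ := fun ξ => by positivity
  set G : 𝓢(ℝ, ℂ) → ℝ → ℂ := fun φ ξ => (𝓕 θ₀ : L2R) ξ * (𝓕⁻ φ) ξ with hGdef
  have hG : ∀ φ, Integrable (G φ) := fun φ => L2R.integrable_mul_schwartz _ _
  have hlG : ∀ φ, Integrable fun ξ => (lam ξ : ℂ) * G φ ξ := fun φ => by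
    refine (L2R.integrable_mul_schwartz (𝓕 θ₀) (𝓕⁻ (Δ φ))).neg.congr
      (Filter.Eventually.of_forall fun ξ => ?_)
    simp only [Pi.neg_apply, hGdef]
    rw [fourierInv_laplacian_apply]
    ring
  set I : 𝓢(ℝ, ℂ) → ℝ → ℂ := fun φ t =>
    ∫ ξ, ((mittagLeffler γ 1 (-(lam ξ * t ^ γ)) : ℝ) : ℂ) * G φ ξ
  set I' : 𝓢(ℝ, ℂ) → ℝ → ℂ := fun φ t =>
    ∫ ξ, ((-lam ξ * (t ^ (γ - 1) * mittagLeffler γ γ (-(lam ξ * t ^ γ))) : ℝ) : ℂ) * G φ ξ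
  have hpair : ∀ φ t, 0 ≤ t → pairing (fracHeat hγ0 hγ1 (abs_nonneg t) θ₀) φ = I φ t := by
    intro φ t ht
    rw [pairing_fracHeat, abs_of_nonneg ht]
  have hderiv : ∀ φ t, 0 < t →
      HasDerivAt (fun t => pairing (fracHeat hγ0 hγ1 (abs_nonneg t) θ₀) φ) (I' φ t) t := by
    intro φ t ht
    refine (hasDerivAt_integral_symbol_mul hγ0 hγ1 hlam hlam0 (hG φ) (hlG φ) ht).congr_of_eventuallyEq
      ?_
    filter_upwards [Ioi_mem_nhds ht] with r hr
    exact hpair φ r (le_of_lt hr)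
  have hbound : ∀ φ t, 0 < t →
      ‖deriv (fun t => pairing (fracHeat hγ0 hγ1 (abs_nonneg t) θ₀) φ) t‖ ≤
        t ^ (γ - 1) / Real.Gamma γ * ∫ ξ, ‖(lam ξ : ℂ) * G φ ξ‖ := fun φ t ht => by
    rw [(hderiv φ t ht).deriv]
    exact norm_integral_deriv_symbol_mul_le hγ0 hγ1 hlam0 (hlG φ) ht
  refine ⟨?_, ?_, ?_, ?_, ?_, ?_⟩
  · intro t _
    refine ContinuousAt.continuousWithinAt (tendsto_L2R_of_symbol
      (Filter.Eventually.of_forall fun s => abs_fracSymbol_le_one hγ0 hγ1 (abs_nonneg s))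
      (abs_fracSymbol_le_one hγ0 hγ1 (abs_nonneg t))
      (Filter.Eventually.of_forall fun s => fourier_fracHeat hγ0 hγ1 (abs_nonneg s) θ₀)
      (fourier_fracHeat hγ0 hγ1 (abs_nonneg t) θ₀) fun ξ => ?_)
    exact (((continuous_mittagLeffler_rpow hγ0 one_pos hγ0 _).comp continuous_abs).tendsto t)
  · refine L2R.ext_fourier ?_
    filter_upwards [fourier_fracHeat hγ0 hγ1 (abs_nonneg 0) θ₀] with ξ h
    rw [h, fracSymbol, abs_zero, Real.zero_rpow hγ0.ne', mul_zero, neg_zero, mittagLeffler_zero]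
    simp
  · exact fun φ t ht => (hderiv φ t ht.1).differentiableAt.differentiableWithinAt
  · intro φ
    rcases le_or_gt T 0 with hT | hT
    · simp [Ioo_eq_empty (not_lt.mpr hT)]
    have h1 : IntegrableOn (fun t : ℝ => t ^ (γ - 1)) (Ioo 0 T) :=
      (intervalIntegrable_iff_integrableOn_Ioo_of_le hT.le).mp
        (intervalIntegral.intervalIntegrable_rpow' (by linarith))
    refine ((h1.div_const (Real.Gamma γ)).mul_const (∫ ξ, ‖(lam ξ : ℂ) * G φ ξ‖)).mono'
      (measurable_deriv _).aestronglyMeasurable ?_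
    filter_upwards [ae_restrict_mem measurableSet_Ioo] with t ht
    exact hbound φ t ht.1
  · intro φ t ht
    have h1 := integrableOn_sub_rpow_mul_rpow hγ0 (sub_pos.mpr hγ1) ht.1
    refine (h1.mul_const ((∫ ξ, ‖(lam ξ : ℂ) * G φ ξ‖) / Real.Gamma γ)).mono' ?_ ?_
    · have h2 : Measurable fun s : ℝ => (((t - s) ^ (-γ) : ℝ) : ℂ) := by fun_prop
      exact (h2.mul (measurable_deriv _)).aestronglyMeasurable
    · filter_upwards [ae_restrict_mem measurableSet_Ioo] with s hs
      have h2 : 0 ≤ t - s := by linarith [hs.2]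
      rw [norm_mul, Complex.norm_real, Real.norm_of_nonneg (Real.rpow_nonneg h2 _),
        show 1 - γ - 1 = -γ by ring, mul_assoc]
      refine mul_le_mul_of_nonneg_left ((hbound φ s hs.1).trans (le_of_eq ?_))
        (Real.rpow_nonneg h2 _)
      ring
  · intro φ t ht
    have hΓ := (Real.Gamma_pos_of_pos (sub_pos.mpr hγ1)).ne'
    have h1 : ∫ s in (0 : ℝ)..t, (((t - s) ^ (-γ) : ℝ) : ℂ) *
        deriv (fun r => pairing (fracHeat hγ0 hγ1 (abs_nonneg r) θ₀) φ) s =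
        ∫ s in (0 : ℝ)..t, (((t - s) ^ (-γ) : ℝ) : ℂ) * I' φ s := by
      rw [intervalIntegral.integral_of_le ht.1.le, intervalIntegral.integral_of_le ht.1.le]
      refine setIntegral_congr_fun measurableSet_Ioc fun s hs => ?_
      rw [(hderiv φ s hs.1).deriv]
    rw [caputoDeriv, h1, integral_kernel_mul_integral_deriv_symbol_mul hγ0 hγ1 hlam hlam0 (hG φ)
      (hlG φ) ht.1, pairing_laplacian, ← mul_assoc, ← Complex.ofReal_mul, one_div,
      inv_mul_cancel₀ hΓ, Complex.ofReal_one, one_mul, sub_eq_zero]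
    refine integral_congr_ae ?_
    filter_upwards [fourier_fracHeat hγ0 hγ1 (abs_nonneg t) θ₀] with ξ h
    rw [h, fracSymbol, abs_of_nonneg ht.1.le]
    simp only [hlamdef, hGdef]
    ring

/-! ### Uniqueness for the fractional heat equation -/

lemma pairing_sub_left (f g : L2R) (φ : 𝓢(ℝ, ℂ)) :
    pairing (f - g) φ = pairing f φ - pairing g φ := by
  rw [pairing, pairing, pairing, ← integral_sub (L2R.integrable_mul_schwartz f φ)
    (L2R.integrable_mul_schwartz g φ)]
  refine integral_congr_ae ?_
  filter_upwards [Lp.coeFn_sub f g] with x hx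
  rw [hx, Pi.sub_apply, sub_mul]

lemma IsFracHeatSolution.sub {γ T : ℝ} {θ₁ θ₂ : L2R} {u v : ℝ → L2R}
    (hu : IsFracHeatSolution γ T θ₁ u) (hv : IsFracHeatSolution γ T θ₂ v) :
    IsFracHeatSolution γ T (θ₁ - θ₂) fun t => u t - v t := by
  have hderiv : ∀ φ, ∀ t ∈ Ioo 0 T, deriv (fun r => pairing (u r - v r) φ) t =
      deriv (fun r => pairing (u r) φ) t - deriv (fun r => pairing (v r) φ) t := by
    intro φ t ht
    simp only [pairing_sub_left]
    exact deriv_fun_sub ((hu.differentiable φ t ht).differentiableAt (isOpen_Ioo.mem_nhds ht))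
      ((hv.differentiable φ t ht).differentiableAt (isOpen_Ioo.mem_nhds ht))
  have hkernel : ∀ φ, ∀ t ∈ Ioo 0 T, EqOn
      (fun s => (((t - s) ^ (-γ) : ℝ) : ℂ) * deriv (fun r => pairing (u r) φ) s -
        (((t - s) ^ (-γ) : ℝ) : ℂ) * deriv (fun r => pairing (v r) φ) s)
      (fun s => (((t - s) ^ (-γ) : ℝ) : ℂ) * deriv (fun r => pairing (u r - v r) φ) s)
      (Ioo 0 t) := by
    intro φ t ht s hs
    simp only
    rw [hderiv φ s ⟨hs.1, hs.2.trans ht.2⟩]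
    ring
  refine ⟨hu.cont.sub hv.cont, by rw [hu.init, hv.init], fun φ => ?_, fun φ => ?_,
    fun φ t ht => ?_, fun φ t ht => ?_⟩
  · simp only [pairing_sub_left]
    exact (hu.differentiable φ).sub (hv.differentiable φ)
  · exact ((hu.integrable φ).sub (hv.integrable φ)).congr_fun
      (fun t ht => (hderiv φ t ht).symm) measurableSet_Ioo
  · exact ((hu.integrable_kernel φ t ht).sub (hv.integrable_kernel φ t ht)).congr_fun
      (hkernel φ t ht) measurableSet_Ioo
  · have hI : caputoDeriv γ (fun r => pairing (u r - v r) φ) t =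
        caputoDeriv γ (fun r => pairing (u r) φ) t - caputoDeriv γ (fun r => pairing (v r) φ) t := by
      rw [caputoDeriv, caputoDeriv, caputoDeriv, ← mul_sub]
      congr 1
      simp only [intervalIntegral.integral_of_le ht.1.le, integral_Ioc_eq_integral_Ioo]
      rw [← integral_sub (hu.integrable_kernel φ t ht) (hv.integrable_kernel φ t ht)]
      exact (setIntegral_congr_fun measurableSet_Ioo (hkernel φ t ht)).symm
    rw [hI, pairing_sub_left]
    linear_combination hu.eqn φ t ht - hv.eqn φ t ht

lemma caputo_integral_rpow {γ b t : ℝ} (hγ1 : γ < 1) (hb : 0 < b) (ht : 0 < t) :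
    ∫ s in (0 : ℝ)..t, (t - s) ^ (-γ) * (b * s ^ (b - 1)) =
      Real.Gamma (1 - γ) * (Real.Gamma (b + 1) / Real.Gamma (b + 1 - γ) * t ^ (b - γ)) := by
  have h := integral_sub_rpow_mul_rpow hb (sub_pos.mpr hγ1) ht
  have h2 : ∫ s in (0 : ℝ)..t, (t - s) ^ (-γ) * (b * s ^ (b - 1)) =
      b * ∫ s in (0 : ℝ)..t, (t - s) ^ (1 - γ - 1) * s ^ (b - 1) := by
    rw [← intervalIntegral.integral_const_mul]
    congr 1
    ext s
    rw [show 1 - γ - 1 = -γ by ring]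
    ring
  rw [h2, h, Real.Gamma_add_one hb.ne', show b + (1 - γ) = b + 1 - γ by ring,
    show b + 1 - γ - 1 = b - γ by ring]
  ring

/-- If `|∂_t^γ f| ≤ A t ^ (b - γ) Γ(b + 1) / Γ(b + 1 - γ) = ∂_t^γ (A t ^ b)` and `f 0 = 0`, then
`|f t| ≤ A t ^ b`: compare `A t ^ b` with the real parts of `c f` for unimodular `c`. -/
lemma norm_le_of_norm_caputo_le {γ T A b : ℝ} {f : ℝ → ℂ} (hγ0 : 0 < γ) (hγ1 : γ < 1)
    (hb : 0 < b) (hcont : ContinuousOn f (Icc 0 T)) (h0 : f 0 = 0)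
    (hd : DifferentiableOn ℝ f (Ioo 0 T))
    (hint : ∀ t ∈ Ioo 0 T,
      IntegrableOn (fun s => (((t - s) ^ (-γ) : ℝ) : ℂ) * deriv f s) (Ioo 0 t))
    (hle : ∀ t ∈ Ioo 0 T, ‖caputoDeriv γ f t‖ ≤
      A * (Real.Gamma (b + 1) / Real.Gamma (b + 1 - γ) * t ^ (b - γ)))
    {t : ℝ} (ht : t ∈ Ioo 0 T) : ‖f t‖ ≤ A * t ^ b := by
  have hΓ := Real.Gamma_pos_of_pos (sub_pos.mpr hγ1)
  -- a unimodular `c` with `c * f t = ‖f t‖`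
  obtain ⟨c, hc1, hc2⟩ : ∃ c : ℂ, ‖c‖ ≤ 1 ∧ (c * f t).re = ‖f t‖ := by
    rcases eq_or_ne (f t) 0 with hz | hz
    · exact ⟨0, by simp, by simp [hz]⟩
    · have hn : ‖f t‖ ≠ 0 := norm_ne_zero_iff.mpr hz
      refine ⟨starRingEnd ℂ (f t) / ‖f t‖, ?_, ?_⟩
      · rw [norm_div, RCLike.norm_conj, Complex.norm_real, norm_norm, div_self hn]
      · rw [div_mul_eq_mul_div, mul_comm, Complex.mul_conj, Complex.normSq_eq_norm_sq,
          ← Complex.ofReal_div, Complex.ofReal_re]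
        field_simp
  set L : ℂ →L[ℝ] ℝ := Complex.reCLM ∘L (ContinuousLinearMap.mul ℝ ℂ c) with hL
  have hLapp : ∀ z, L z = (c * z).re := fun z => rfl
  have hpow : ∀ s : ℝ, 0 < s → HasDerivAt (fun s : ℝ => A * s ^ b) (A * (b * s ^ (b - 1))) s :=
    fun s hs => (Real.hasDerivAt_rpow_const (Or.inl hs.ne')).const_mul A
  have hfd : ∀ s ∈ Ioo 0 T, HasDerivAt (fun s => L (f s)) (L (deriv f s)) s := fun s hs =>
    L.hasFDerivAt.comp_hasDerivAt s
      ((hd s hs).differentiableAt (isOpen_Ioo.mem_nhds hs)).hasDerivAt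
  have hgd : ∀ s ∈ Ioo 0 T, HasDerivAt (fun s => A * s ^ b - L (f s))
      (A * (b * s ^ (b - 1)) - L (deriv f s)) s := fun s hs => (hpow s hs.1).sub (hfd s hs)
  have hsmul : ∀ (r : ℝ) (z : ℂ), L ((r : ℂ) * z) = r * L z := fun r z => by
    rw [← Complex.real_smul, map_smul, smul_eq_mul]
  have hint1 : ∀ r ∈ Ioo 0 T,
      IntegrableOn (fun s => (r - s) ^ (-γ) * (A * (b * s ^ (b - 1)))) (Ioo 0 r) := by
    intro r hr
    have h1 := (integrableOn_sub_rpow_mul_rpow hb (sub_pos.mpr hγ1) hr.1).const_mul (A * b)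
    refine IntegrableOn.congr_fun h1 (fun s _ => ?_) measurableSet_Ioo
    simp only [show 1 - γ - 1 = -γ by ring]
    ring
  have hint2 : ∀ r ∈ Ioo 0 T,
      IntegrableOn (fun s => (r - s) ^ (-γ) * L (deriv f s)) (Ioo 0 r) := by
    intro r hr
    have h1 : IntegrableOn (fun s => L ((((r - s) ^ (-γ) : ℝ) : ℂ) * deriv f s)) (Ioo 0 r) :=
      L.integrable_comp (hint r hr)
    simpa only [hsmul] using h1
  have hEq : ∀ r ∈ Ioo 0 T, EqOn
      (fun s => (r - s) ^ (-γ) * (A * (b * s ^ (b - 1))) - (r - s) ^ (-γ) * L (deriv f s))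
      (fun s => (r - s) ^ (-γ) * deriv (fun s => A * s ^ b - L (f s)) s) (Ioo 0 r) := by
    intro r hr s hs
    simp only
    rw [(hgd s ⟨hs.1, hs.2.trans hr.2⟩).deriv]
    ring
  have h := nonneg_of_caputo_nonneg (g := fun s => A * s ^ b - L (f s)) (T := T) hγ0 hγ1
    ((continuousOn_const.mul (continuousOn_id.rpow_const fun _ _ => Or.inr hb.le)).sub
      (L.continuous.comp_continuousOn hcont))
    (fun s hs => (hgd s hs).differentiableAt.differentiableWithinAt)
    (fun r hr => ((hint1 r hr).sub (hint2 r hr)).congr_fun (hEq r hr) measurableSet_Ioo)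
    (by simp [h0, Real.zero_rpow hb.ne'])
    (fun r hr _ => by
      have hIL : ∫ s in Ioo 0 r, (r - s) ^ (-γ) * L (deriv f s) =
          Real.Gamma (1 - γ) * L (caputoDeriv γ f r) := by
        rw [caputoDeriv, hsmul, ← mul_assoc, mul_one_div_cancel hΓ.ne', one_mul,
          intervalIntegral.integral_of_le hr.1.le, integral_Ioc_eq_integral_Ioo,
          ← L.integral_comp_comm (hint r hr)]
        simp only [hsmul]
      have hIA : ∫ s in Ioo 0 r, (r - s) ^ (-γ) * (A * (b * s ^ (b - 1))) = Real.Gamma (1 - γ) *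
          (A * (Real.Gamma (b + 1) / Real.Gamma (b + 1 - γ) * r ^ (b - γ))) := by
        have h1 := caputo_integral_rpow hγ1 hb hr.1
        rw [intervalIntegral.integral_of_le hr.1.le, integral_Ioc_eq_integral_Ioo] at h1
        rw [mul_left_comm, ← h1, ← integral_const_mul]
        congr 1
        ext s
        ring
      rw [intervalIntegral.integral_of_le hr.1.le, integral_Ioc_eq_integral_Ioo,
        ← setIntegral_congr_fun measurableSet_Ioo (hEq r hr),
        integral_sub (hint1 r hr) (hint2 r hr), hIL, hIA, ← mul_sub]
      refine mul_nonneg hΓ.le (sub_nonneg.mpr (le_trans ?_ (hle r hr)))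
      rw [hLapp]
      refine (Complex.re_le_norm _).trans ?_
      rw [norm_mul]
      exact mul_le_of_le_one_left (norm_nonneg _) hc1)
    ht
  have h' : 0 ≤ A * t ^ b - (c * f t).re := h
  rw [hc2] at h'
  linarith

lemma continuous_pairing (φ : 𝓢(ℝ, ℂ)) : Continuous fun f : L2R => pairing f φ := by
  have h : LipschitzWith ‖(𝓕⁻ φ).toLp 2‖₊ fun f : L2R => pairing f φ := by
    refine LipschitzWith.of_dist_le_mul fun f g => ?_
    rw [dist_eq_norm, dist_eq_norm, ← pairing_sub_left, mul_comm]
    exact norm_pairing_le _ _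
  exact h.continuous

/-- On test functions with frequencies `|ω| ≤ R` the Laplacian has norm at most `R ^ 2`. -/
lemma norm_fourierInv_laplacian_le {φ : 𝓢(ℝ, ℂ)} {R : ℝ}
    (hφ : ∀ ξ, (𝓕⁻ φ) ξ ≠ 0 → |2 * Real.pi * ξ| ≤ R) :
    ‖(𝓕⁻ (Δ φ)).toLp 2‖ ≤ R ^ 2 * ‖(𝓕⁻ φ).toLp 2‖ := by
  refine Lp.norm_le_mul_norm_of_ae_le_mul ?_
  filter_upwards [(𝓕⁻ (Δ φ)).coeFn_toLp 2, (𝓕⁻ φ).coeFn_toLp 2] with ξ h1 h2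
  rw [h1, h2, fourierInv_laplacian_apply, norm_mul, norm_neg, Complex.norm_real,
    Real.norm_of_nonneg (by positivity)]
  rcases eq_or_ne ((𝓕⁻ φ) ξ) 0 with h0 | h0
  · rw [h0]; simp
  · have := hφ ξ h0
    gcongr

lemma IsFracHeatSolution.norm_pairing_le_of_bandLimited {γ T : ℝ} (hγ0 : 0 < γ) (hγ1 : γ < 1)
    {d : ℝ → L2R} (hd : IsFracHeatSolution γ T 0 d) {M R : ℝ} (hM : ∀ t ∈ Icc 0 T, ‖d t‖ ≤ M)
    (n : ℕ) : ∀ φ : 𝓢(ℝ, ℂ), (∀ ξ, (𝓕⁻ φ) ξ ≠ 0 → |2 * Real.pi * ξ| ≤ R) → ∀ t ∈ Ioo 0 T,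
      ‖pairing (d t) φ‖ ≤
        M * ‖(𝓕⁻ φ).toLp 2‖ * (R ^ 2) ^ n / Real.Gamma (γ * n + 1) * t ^ (γ * n) := by
  induction n with
  | zero =>
    intro φ _ t ht
    simp only [CharP.cast_eq_zero, mul_zero, zero_add, Real.Gamma_one, pow_zero, mul_one, div_one,
      Real.rpow_zero]
    exact (norm_pairing_le _ _).trans
      (mul_le_mul_of_nonneg_right (hM t ⟨ht.1.le, ht.2.le⟩) (norm_nonneg _))
  | succ n ih =>
    intro φ hφ t ht
    have hb : 0 < γ * ((n + 1 : ℕ) : ℝ) := by positivity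
    have hM0 : 0 ≤ M := (norm_nonneg _).trans (hM t ⟨ht.1.le, ht.2.le⟩)
    have hΓn := Gamma_mittagLeffler_index_pos hγ0 one_pos n
    have hΓn1 := Gamma_mittagLeffler_index_pos hγ0 one_pos (n + 1)
    refine norm_le_of_norm_caputo_le (f := fun t => pairing (d t) φ) hγ0 hγ1 hb
      ((continuous_pairing φ).comp_continuousOn hd.cont) ?_ (hd.differentiable φ)
      (hd.integrable_kernel φ) (fun s hs => ?_) ht
    · rw [hd.init]
      have := norm_pairing_le 0 φ
      rw [norm_zero, zero_mul] at this
      exact norm_le_zero_iff.mp this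
    · have hΔ : ∀ ξ, (𝓕⁻ (Δ φ)) ξ ≠ 0 → |2 * Real.pi * ξ| ≤ R := fun ξ hξ => hφ ξ fun h0 => hξ (by
        rw [fourierInv_laplacian_apply, h0, mul_zero])
      rw [sub_eq_zero.mp (hd.eqn φ s hs)]
      refine (ih (Δ φ) hΔ s hs).trans ?_
      have h1 := norm_fourierInv_laplacian_le hφ
      have h2 : 0 ≤ s ^ (γ * n) := Real.rpow_nonneg hs.1.le _
      rw [show γ * ((n + 1 : ℕ) : ℝ) + 1 - γ = γ * n + 1 by push_cast; ring,
        show γ * ((n + 1 : ℕ) : ℝ) - γ = γ * n by push_cast; ring]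
      generalize ‖(𝓕⁻ (Δ φ)).toLp 2‖ = N₁ at h1 ⊢
      generalize ‖(𝓕⁻ φ).toLp 2‖ = N₂ at h1 ⊢
      generalize Real.Gamma (γ * n + 1) = Γ₁ at hΓn ⊢
      generalize Real.Gamma (γ * ((n + 1 : ℕ) : ℝ) + 1) = Γ₂ at hΓn1 ⊢
      generalize s ^ (γ * n) = p at h2 ⊢
      calc M * N₁ * (R ^ 2) ^ n / Γ₁ * p ≤ M * (R ^ 2 * N₂) * (R ^ 2) ^ n / Γ₁ * p := by gcongr
        _ = M * N₂ * (R ^ 2) ^ (n + 1) / Γ₂ * (Γ₂ / Γ₁ * p) := by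
          field_simp
          ring

/-- A solution with zero initial state vanishes: the bounds of
`IsFracHeatSolution.norm_pairing_le_of_bandLimited` are terms of a convergent Mittag-Leffler
series. -/
lemma IsFracHeatSolution.eq_zero {γ T : ℝ} (hγ0 : 0 < γ) (hγ1 : γ < 1) (hT : 0 < T)
    {d : ℝ → L2R} (hd : IsFracHeatSolution γ T 0 d) : d T = 0 := by
  obtain ⟨M, hM⟩ := isCompact_Icc.exists_bound_of_continuousOn hd.cont
  have hzero : ∀ t ∈ Ioo 0 T, d t = 0 := by
    intro t ht
    refine L2R.eq_zero_of_pairing _ fun φ hφ => ?_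
    obtain ⟨R, hR⟩ := hφ.isCompact.exists_bound_of_continuousOn
      (f := fun ξ : ℝ => 2 * Real.pi * ξ) (by fun_prop)
    have hband : ∀ ξ, (𝓕⁻ φ) ξ ≠ 0 → |2 * Real.pi * ξ| ≤ R := fun ξ hξ =>
      hR ξ (subset_tsupport _ hξ)
    have hlim : Filter.Tendsto (fun n : ℕ => M * ‖(𝓕⁻ φ).toLp 2‖ *
        ((R ^ 2 * t ^ γ) ^ n / Real.Gamma (γ * n + 1))) Filter.atTop (nhds 0) := by
      simpa using ((summable_mittagLeffler hγ0 one_pos (R ^ 2 * t ^ γ)).tendsto_atTop_zero).const_mul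
        (M * ‖(𝓕⁻ φ).toLp 2‖)
    refine norm_le_zero_iff.mp (ge_of_tendsto' hlim fun n => ?_)
    refine (hd.norm_pairing_le_of_bandLimited hγ0 hγ1 hM n φ hband t ht).trans (le_of_eq ?_)
    rw [Real.rpow_mul ht.1.le, Real.rpow_natCast, mul_pow]
    ring
  have hclos : T ∈ closure (Ioo 0 T) := by
    rw [closure_Ioo hT.ne]
    exact right_mem_Icc.mpr hT.le
  have hcont : ContinuousWithinAt d (Ioo 0 T) T :=
    (hd.cont T (right_mem_Icc.mpr hT.le)).mono Ioo_subset_Icc_self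
  have : (nhdsWithin T (Ioo 0 T)).NeBot := mem_closure_iff_nhdsWithin_neBot.mp hclos
  refine tendsto_nhds_unique hcont (tendsto_const_nhds.congr' ?_)
  filter_upwards [self_mem_nhdsWithin] with t ht
  exact (hzero t ht).symm

lemma isFinalStateOperator_fracHeat {γ T : ℝ} (hγ0 : 0 < γ) (hγ1 : γ < 1) (hT : 0 < T) :
    IsFinalStateOperator γ T (fracHeat hγ0 hγ1 hT.le) := by
  intro θ₀
  have hsol := isFracHeatSolution_fracHeat (T := T) hγ0 hγ1 θ₀
  refine ⟨⟨_, hsol⟩, fun u hu => ?_⟩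
  have hsub := hu.sub hsol
  rw [sub_self] at hsub
  have h := sub_eq_zero.mp (hsub.eq_zero hγ0 hγ1 hT)
  rw [h]
  simp only [abs_of_pos hT]

lemma IsFinalStateOperator.unique {γ T : ℝ} {K K' : L2R →L[ℂ] L2R}
    (hK : IsFinalStateOperator γ T K) (hK' : IsFinalStateOperator γ T K') : K = K' := by
  ext1 θ₀
  obtain ⟨u, hu⟩ := (hK θ₀).1
  rw [← (hK θ₀).2 u hu, (hK' θ₀).2 u hu]

/-! ### Frequency support of wavelets -/

/-- The dilated frequency annulus `{ξ : a 2 ^ j ≤ |2πξ| ≤ b 2 ^ j}`. -/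
def annulus (a b : ℝ) (j : ℤ) : Set ℝ :=
  {ξ | a * 2 ^ j ≤ |2 * Real.pi * ξ| ∧ |2 * Real.pi * ξ| ≤ b * 2 ^ j}

lemma isClosed_annulus (a b : ℝ) (j : ℤ) : IsClosed (annulus a b j) :=
  have h : Continuous fun ξ : ℝ => |2 * Real.pi * ξ| := by fun_prop
  (isClosed_le continuous_const h).inter (isClosed_le h continuous_const)

lemma measurableSet_annulus (a b : ℝ) (j : ℤ) : MeasurableSet (annulus a b j) :=
  (isClosed_annulus a b j).measurableSet

lemma integral_comp_affine (h : ℝ → ℂ) {s : ℝ} (hs : 0 < s) (k : ℝ) :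
    ∫ x, h (s * x - k) = ((s⁻¹ : ℝ) : ℂ) * ∫ x, h x := by
  rw [Measure.integral_comp_mul_left (fun y => h (y - k)) s, integral_sub_right_eq_self h k,
    abs_of_pos (inv_pos.mpr hs), Complex.real_smul]

lemma fourierInv_comp_affine (g : ℝ → ℂ) {s : ℝ} (hs : 0 < s) (k ξ : ℝ) :
    𝓕⁻ (fun y => g (s⁻¹ * (y + k))) ξ =
      (s * Complex.exp (-(2 * Real.pi * k * ξ * Complex.I))) * 𝓕⁻ g (s * ξ) := by
  rw [Real.fourierInv_eq', Real.fourierInv_eq']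
  set h : ℝ → ℂ := fun y =>
    Complex.exp (↑(2 * Real.pi * inner ℝ y ξ) * Complex.I) • g (s⁻¹ * (y + k)) with hh
  have h1 := integral_comp_affine h hs k
  have h2 : ∀ x, h (s * x - k) = Complex.exp (-(2 * Real.pi * k * ξ * Complex.I)) *
      (Complex.exp (↑(2 * Real.pi * inner ℝ x (s * ξ)) * Complex.I) • g x) := by
    intro x
    simp only [hh, smul_eq_mul, RCLike.inner_apply, conj_trivial]
    rw [show s⁻¹ * (s * x - k + k) = x by field_simp; ring,
      ← mul_assoc (Complex.exp (-(2 * Real.pi * k * ξ * Complex.I))), ← Complex.exp_add]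
    congr 2
    push_cast
    ring
  simp only [h2] at h1
  rw [integral_const_mul] at h1
  rw [mul_assoc, h1, ← mul_assoc, ← Complex.ofReal_mul, mul_inv_cancel₀ hs.ne',
    Complex.ofReal_one, one_mul]

/-- Dilations and translations act on frequency supports: the Fourier transform of
`ψ^{j,k}` lives in the annulus of scale `j`. By duality it suffices to test against Schwartz
functions `χ` supported off that annulus; the inverse Fourier transform of the
correspondingly dilated and translated `𝓕 χ` vanishes on the annulus of scale `0`. -/
lemma fourier_wavelet_support {ψ f : L2R} {l : ℤ × ℤ} {a b : ℝ}
    (hf : (f : ℝ → ℂ) =ᵐ[volume] waveletFun ψ l)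
    (hψ : ∀ᵐ ξ : ℝ, (𝓕 ψ : L2R) ξ ≠ 0 → a ≤ |2 * Real.pi * ξ| ∧ |2 * Real.pi * ξ| ≤ b) :
    ∀ᵐ ξ : ℝ, (𝓕 f : L2R) ξ ≠ 0 → ξ ∈ annulus a b l.1 := by
  set s : ℝ := 2 ^ l.1 with hs
  have hs0 : 0 < s := by positivity
  have hloc := ((Lp.memLp (𝓕 f : L2R)).locallyIntegrable (by norm_num)).locallyIntegrableOn
    (annulus a b l.1)ᶜ
  have h := (isClosed_annulus a b l.1).isOpen_compl.ae_eq_zero_of_integral_contDiff_smul_eq_zero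
    hloc fun g hg hgs hgU => ?_
  · filter_upwards [h] with ξ h1 h2
    by_contra h3
    exact h2 (h1 h3)
  have hg₁ : HasCompactSupport (Complex.ofRealCLM ∘ g) := hgs.comp_left rfl
  have hg₂ : ContDiff ℝ (⊤ : ℕ∞) (Complex.ofRealCLM ∘ g) := by fun_prop
  set χ : 𝓢(ℝ, ℂ) := hg₁.toSchwartzMap hg₂ with hχ
  have hχapp : ∀ ξ, χ ξ = (g ξ : ℂ) := fun ξ => rfl
  set Φ : 𝓢(ℝ, ℂ) := SchwartzMap.compSubConstCLM ℂ (-(l.2 : ℝ))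
    (SchwartzMap.compCLMOfContinuousLinearEquiv ℂ
      (ContinuousLinearEquiv.unitsEquivAut ℝ (Units.mk0 s⁻¹ (inv_ne_zero hs0.ne'))) (𝓕 χ)) with hΦ
  have hΦapp : ∀ y, Φ y = (𝓕 χ) (s⁻¹ * (y + l.2)) := fun y => by
    simp [hΦ, mul_comm]
  have hΦinv : ∀ ξ : ℝ, (𝓕⁻ Φ) ξ =
      (s * Complex.exp (-(2 * Real.pi * (l.2 : ℝ) * ξ * Complex.I))) * (g (s * ξ) : ℂ) := by
    intro ξ
    have h1 : (Φ : ℝ → ℂ) = fun y => (𝓕 χ : 𝓢(ℝ, ℂ)) (s⁻¹ * (y + l.2)) := funext hΦapp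
    rw [SchwartzMap.fourierInv_coe, h1, fourierInv_comp_affine _ hs0, ← SchwartzMap.fourierInv_coe,
      FourierTransform.fourierInv_fourier_eq, hχapp]
  have h1 : pairing f (𝓕 χ) =
      (((2 : ℝ) ^ ((l.1 : ℝ) / 2) : ℝ) : ℂ) * (((s⁻¹ : ℝ) : ℂ) * pairing ψ Φ) := by
    rw [pairing, pairing, ← integral_comp_affine _ hs0 (l.2 : ℝ), ← integral_const_mul]
    refine integral_congr_ae ?_
    filter_upwards [hf] with x hx
    rw [hx, waveletFun, hΦapp, show s⁻¹ * (s * x - l.2 + l.2) = x by field_simp; ring]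
    ring
  have h2 : pairing ψ Φ = 0 := by
    rw [pairing_eq_integral_fourier]
    refine integral_eq_zero_of_ae ?_
    filter_upwards [hψ] with ξ hξ
    rcases eq_or_ne ((𝓕 ψ : L2R) ξ) 0 with h0 | h0
    · rw [h0]; simp
    · have h3 := hξ h0
      have h4 : s * ξ ∈ annulus a b l.1 := by
        have : |2 * Real.pi * (s * ξ)| = |2 * Real.pi * ξ| * s := by
          rw [show 2 * Real.pi * (s * ξ) = 2 * Real.pi * ξ * s by ring, abs_mul, abs_of_pos hs0]
        rw [annulus, mem_ofPred_eq, this]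
        exact ⟨mul_le_mul_of_nonneg_right h3.1 hs0.le, mul_le_mul_of_nonneg_right h3.2 hs0.le⟩
      have h5 : g (s * ξ) = 0 := by
        by_contra h6
        exact hgU (subset_tsupport _ h6) h4
      rw [hΦinv, h5]
      simp
  rw [h2, mul_zero, mul_zero, pairing_eq_integral_fourier,
    FourierTransform.fourierInv_fourier_eq] at h1
  rw [← h1]
  congr 1
  ext ξ
  rw [hχapp, Complex.real_smul, mul_comm]

/-- Every frequency lies in at most `N` of the annuli if `b < a 2 ^ N`. -/
lemma sum_indicator_annulus_le {a b : ℝ} {N : ℕ} (ha : 0 < a) (hN : b < a * 2 ^ N)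
    (J : Finset ℤ) (ξ : ℝ) :
    ∑ j ∈ J, (annulus a b j).indicator (fun _ => (1 : ℝ)) ξ ≤ N := by
  classical
  have h1 : ∑ j ∈ J, (annulus a b j).indicator (fun _ => (1 : ℝ)) ξ =
      ((J.filter fun j => ξ ∈ annulus a b j).card : ℝ) := by
    rw [Finset.card_filter]
    push_cast
    refine Finset.sum_congr rfl fun j _ => ?_
    simp [indicator_apply]
  rw [h1, Nat.cast_le]
  set S := J.filter fun j => ξ ∈ annulus a b j
  rcases S.eq_empty_or_nonempty with hS | hS
  · rw [hS]; simp
  set j₀ := S.min' hS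
  have hj₀ : ξ ∈ annulus a b j₀ := (Finset.mem_filter.mp (S.min'_mem hS)).2
  have hsub : S ⊆ Finset.Ico j₀ (j₀ + N) := by
    intro j hj
    have hja : ξ ∈ annulus a b j := (Finset.mem_filter.mp hj).2
    refine Finset.mem_Ico.mpr ⟨S.min'_le j hj, ?_⟩
    have h2 : a * (2 : ℝ) ^ j < a * 2 ^ (j₀ + N) := by
      calc a * (2 : ℝ) ^ j ≤ b * 2 ^ j₀ := hja.1.trans hj₀.2
        _ < a * 2 ^ N * 2 ^ j₀ := by gcongr
        _ = a * 2 ^ (j₀ + N) := by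
            rw [zpow_add₀ two_ne_zero, zpow_natCast]
            ring
    exact (zpow_lt_zpow_iff_right₀ one_lt_two).mp (lt_of_mul_lt_mul_left h2 ha.le)
  simpa using Finset.card_le_card hsub

/-- The Bessel bound for band-limited perturbations of an orthonormal wavelet system: on each scale
`⟨x, w_{j,k}⟩ = ⟨y_j, u_{j,k}⟩` where `y_j` is `x` filtered by the symbol `W_j` on the annulus of
scale `j`; Bessel's inequality bounds the sum over `k` by `‖y_j‖²`, and the annuli have finite
overlap. -/
lemma bessel_of_annulus_support {a b C : ℝ} {N : ℕ} (ha : 0 < a) (hN : b < a * 2 ^ N)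
    {u w : ℤ × ℤ → L2R} (hu : Orthonormal ℂ u) {W : ℤ → ℝ → ℝ} (hWm : ∀ j, Measurable (W j))
    (hC : 0 ≤ C) (hWC : ∀ j, ∀ ξ ∈ annulus a b j, |W j ξ| ≤ C)
    (hband : ∀ l, ∀ᵐ ξ : ℝ, (𝓕 (u l) : L2R) ξ ≠ 0 → ξ ∈ annulus a b l.1)
    (hw : ∀ l, ((𝓕 (w l) : L2R) : ℝ → ℂ) =ᵐ[volume] fun ξ => (W l.1 ξ : ℂ) * (𝓕 (u l) : L2R) ξ)
    (x : L2R) :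
    Summable (fun l => ‖inner ℂ x (w l)‖ ^ 2) ∧
      ∑' l, ‖inner ℂ x (w l)‖ ^ 2 ≤ C ^ 2 * N * ‖x‖ ^ 2 := by
  classical
  set m : ℤ → ℝ → ℝ := fun j => (annulus a b j).indicator (W j) with hm
  have hmC : ∀ j ξ, |m j ξ| ≤ C := fun j ξ => by
    by_cases hξ : ξ ∈ annulus a b j
    · simp only [hm, indicator_of_mem hξ]
      exact hWC j ξ hξ
    · simp only [hm, indicator_of_notMem hξ, abs_zero]
      exact hC
  have hmem : ∀ j, MemLp (fun ξ => (m j ξ : ℂ)) ∞ (volume : Measure ℝ) := fun j =>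
    memLp_top_ofReal ((hWm j).indicator (measurableSet_annulus a b j)) (hmC j)
  set y : ℤ → L2R := fun j => fourierMul (m j) (hmem j) x with hy
  have hinner : ∀ l, ‖inner ℂ x (w l)‖ = ‖inner ℂ (u l) (y l.1)‖ := by
    intro l
    rw [norm_inner_symm (u l), hy, inner_fourierMul_left]
    congr 2
    refine L2R.ext_fourier ?_
    filter_upwards [hw l, hband l, fourier_fourierMul (hmem l.1) (u l)] with ξ h1 h2 h3
    rw [h1, h3]
    rcases eq_or_ne ((𝓕 (u l) : L2R) ξ) 0 with h0 | h0
    · rw [h0]; simp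
    · simp only [hm, indicator_of_mem (h2 h0)]
  have hind : ∀ j, Integrable fun ξ =>
      (annulus a b j).indicator (fun _ => (1 : ℝ)) ξ * ‖(𝓕 x : L2R) ξ‖ ^ 2 := fun j => by
    have := (L2R.integrable_norm_sq (𝓕 x)).indicator (measurableSet_annulus a b j)
    refine this.congr (Filter.Eventually.of_forall fun ξ => ?_)
    by_cases hξ : ξ ∈ annulus a b j <;> simp [hξ]
  have hynorm : ∀ j, ‖y j‖ ^ 2 ≤
      ∫ ξ, C ^ 2 * ((annulus a b j).indicator (fun _ => (1 : ℝ)) ξ * ‖(𝓕 x : L2R) ξ‖ ^ 2) := by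
    intro j
    rw [← Lp.norm_fourier_eq, L2R.norm_sq_eq_integral]
    refine integral_mono_ae (L2R.integrable_norm_sq _) ((hind j).const_mul _) ?_
    filter_upwards [fourier_fourierMul (hmem j) x] with ξ h1
    rw [h1, norm_mul, mul_pow, Complex.norm_real, Real.norm_eq_abs]
    by_cases hξ : ξ ∈ annulus a b j
    · have := hmC j ξ
      simp only [indicator_of_mem hξ, one_mul]
      gcongr
    · simp [hm, hξ]
  have hfin : ∀ s : Finset (ℤ × ℤ),
      ∑ l ∈ s, ‖inner ℂ x (w l)‖ ^ 2 ≤ C ^ 2 * N * ‖x‖ ^ 2 := by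
    intro s
    set J := s.image Prod.fst
    set k := s.image Prod.snd
    have hsub : s ⊆ J ×ˢ k := fun l hl => Finset.mem_product.mpr
      ⟨Finset.mem_image_of_mem _ hl, Finset.mem_image_of_mem _ hl⟩
    calc ∑ l ∈ s, ‖inner ℂ x (w l)‖ ^ 2
        ≤ ∑ l ∈ J ×ˢ k, ‖inner ℂ x (w l)‖ ^ 2 :=
          Finset.sum_le_sum_of_subset_of_nonneg hsub fun _ _ _ => by positivity
      _ = ∑ j ∈ J, ∑ i ∈ k, ‖inner ℂ (u (j, i)) (y j)‖ ^ 2 := by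
          rw [Finset.sum_product]
          simp only [hinner]
      _ ≤ ∑ j ∈ J, ‖y j‖ ^ 2 := Finset.sum_le_sum fun j _ =>
          (hu.comp (fun i : ℤ => (j, i)) (Prod.mk_right_injective j)).sum_inner_products_le (y j)
      _ ≤ ∑ j ∈ J, ∫ ξ, C ^ 2 *
            ((annulus a b j).indicator (fun _ => (1 : ℝ)) ξ * ‖(𝓕 x : L2R) ξ‖ ^ 2) :=
          Finset.sum_le_sum fun j _ => hynorm j
      _ = ∫ ξ, ∑ j ∈ J, C ^ 2 *
            ((annulus a b j).indicator (fun _ => (1 : ℝ)) ξ * ‖(𝓕 x : L2R) ξ‖ ^ 2) :=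
          (integral_finsetSum _ fun j _ => (hind j).const_mul _).symm
      _ ≤ ∫ ξ, C ^ 2 * N * ‖(𝓕 x : L2R) ξ‖ ^ 2 := by
          refine integral_mono (integrable_finsetSum _ fun j _ => (hind j).const_mul _)
            ((L2R.integrable_norm_sq _).const_mul _) fun ξ => ?_
          simp only
          rw [← Finset.mul_sum, ← Finset.sum_mul, mul_assoc]
          have := sum_indicator_annulus_le ha hN J ξ
          gcongr
      _ = C ^ 2 * N * ‖x‖ ^ 2 := by
          rw [integral_const_mul, ← L2R.norm_sq_eq_integral, Lp.norm_fourier_eq]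
  exact ⟨summable_of_sum_le (fun _ => by positivity) hfin,
    Real.tsum_le_of_sum_le (fun _ => by positivity) hfin⟩

/-! ### Frames -/

section AbstractFrames

variable {X Y Λ : Type*}
  [NormedAddCommGroup X] [InnerProductSpace ℂ X] [NormedAddCommGroup Y] [InnerProductSpace ℂ Y]

lemma HilbertBasis.hasSum_norm_inner_sq (u : HilbertBasis Λ ℂ X) (x : X) :
    HasSum (fun l => ‖inner ℂ x (u l)‖ ^ 2) (‖x‖ ^ 2) := by
  have h := u.hasSum_inner_mul_inner x x
  rw [inner_self_eq_norm_sq_to_K] at h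
  rw [← Complex.hasSum_ofReal]
  convert! h using 1
  · ext l
    rw [← inner_conj_symm (u l) x, RCLike.mul_conj]
    push_cast
    rfl
  · push_cast
    rfl

lemma norm_inner_sq_le_two_mul (x y w : X) :
    ‖inner ℂ x w‖ ^ 2 ≤ 2 * ‖inner ℂ y w‖ ^ 2 + 2 * ‖inner ℂ (x - y) w‖ ^ 2 := by
  have h : ‖inner ℂ x w‖ ≤ ‖inner ℂ y w‖ + ‖inner ℂ (x - y) w‖ := by
    rw [inner_sub_left]
    have := norm_add_le (inner ℂ y w) (inner ℂ x w - inner ℂ y w)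
    rwa [add_sub_cancel] at this
  nlinarith [norm_nonneg (inner ℂ x w), sq_nonneg (‖inner ℂ y w‖ - ‖inner ℂ (x - y) w‖)]

/-- The lower frame bound for a biorthogonal pair of Bessel families `v`, `w` with
`K* v_λ = κ_λ u_λ` and `K u_λ = κ_λ w_λ`: on the range of `K` there is the expansion
`‖x‖² = ∑ ⟨x, v_λ⟩ ⟨w_λ, x⟩`, so the Bessel bound of `w` is a lower bound for `v`; it passes to the
closure because `v` is a Bessel family. -/
lemma norm_sq_le_of_biorthogonal_bessel [CompleteSpace X] [CompleteSpace Y] (K : X →L[ℂ] Y)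
    (u : HilbertBasis Λ ℂ X) {v w : Λ → Y} {κ : Λ → ℝ}
    (hv : ∀ l, ContinuousLinearMap.adjoint K (v l) = (κ l : ℂ) • u l)
    (hw : ∀ l, K (u l) = (κ l : ℂ) • w l) {B B' : ℝ} (hB' : 0 < B')
    (hBv : ∀ x, Summable (fun l => ‖inner ℂ x (v l)‖ ^ 2) ∧
      ∑' l, ‖inner ℂ x (v l)‖ ^ 2 ≤ B * ‖x‖ ^ 2)
    (hBw : ∀ x, Summable (fun l => ‖inner ℂ x (w l)‖ ^ 2) ∧
      ∑' l, ‖inner ℂ x (w l)‖ ^ 2 ≤ B' * ‖x‖ ^ 2)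
    {x : Y} (hx : x ∈ (LinearMap.range (K : X →ₗ[ℂ] Y)).topologicalClosure) :
    ‖x‖ ^ 2 ≤ 2 * B' * ∑' l, ‖inner ℂ x (v l)‖ ^ 2 := by
  have hran : ∀ y, ‖K y‖ ^ 2 ≤ B' * ∑' l, ‖inner ℂ (K y) (v l)‖ ^ 2 := by
    intro y
    have h1 := u.hasSum_inner_mul_inner y (ContinuousLinearMap.adjoint K (K y))
    rw [ContinuousLinearMap.adjoint_inner_right, inner_self_eq_norm_sq_to_K] at h1
    have hterm : ∀ l, inner ℂ y (u l) * inner ℂ (u l) (ContinuousLinearMap.adjoint K (K y)) =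
        inner ℂ (K y) (v l) * inner ℂ (w l) (K y) := by
      intro l
      rw [ContinuousLinearMap.adjoint_inner_right, hw, ← ContinuousLinearMap.adjoint_inner_right,
        hv, inner_smul_left, inner_smul_right, Complex.conj_ofReal]
      ring
    simp only [hterm] at h1
    set x := K y
    -- the inequality `αβ ≤ (B' α² + β² / B') / 2` absorbs the Bessel sum of `w` into the left side
    have hle : ∀ l, ‖inner ℂ x (v l) * inner ℂ (w l) x‖ ≤
        B' / 2 * ‖inner ℂ x (v l)‖ ^ 2 + 1 / (2 * B') * ‖inner ℂ x (w l)‖ ^ 2 := by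
      intro l
      rw [norm_mul, norm_inner_symm (w l) x]
      have h2 : B' / 2 * ‖inner ℂ x (v l)‖ ^ 2 + 1 / (2 * B') * ‖inner ℂ x (w l)‖ ^ 2 -
          ‖inner ℂ x (v l)‖ * ‖inner ℂ x (w l)‖ =
          1 / (2 * B') * (B' * ‖inner ℂ x (v l)‖ - ‖inner ℂ x (w l)‖) ^ 2 := by
        field_simp
        ring
      have h3 : 0 ≤ 1 / (2 * B') * (B' * ‖inner ℂ x (v l)‖ - ‖inner ℂ x (w l)‖) ^ 2 := by
        positivity
      linarith
    have hs := ((hBv x).1.mul_left (B' / 2)).add ((hBw x).1.mul_left (1 / (2 * B')))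
    have h4 := tsum_of_norm_bounded hs.hasSum hle
    rw [h1.tsum_eq, Summable.tsum_add ((hBv x).1.mul_left _) ((hBw x).1.mul_left _),
      tsum_mul_left, tsum_mul_left] at h4
    have h5 : ‖((‖x‖ : ℂ)) ^ 2‖ = ‖x‖ ^ 2 := by
      rw [norm_pow, Complex.norm_real, norm_norm]
    have h6 : 1 / (2 * B') * ∑' l, ‖inner ℂ x (w l)‖ ^ 2 ≤ 1 / 2 * ‖x‖ ^ 2 := by
      have : 1 / (2 * B') * ∑' l, ‖inner ℂ x (w l)‖ ^ 2 ≤ 1 / (2 * B') * (B' * ‖x‖ ^ 2) := by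
        have := (hBw x).2
        gcongr
      refine this.trans (le_of_eq ?_)
      field_simp
    have h7 : ‖x‖ ^ 2 ≤ B' / 2 * ∑' l, ‖inner ℂ x (v l)‖ ^ 2 +
        1 / (2 * B') * ∑' l, ‖inner ℂ x (w l)‖ ^ 2 := h5 ▸ h4
    linarith
  obtain ⟨z, hz, hlim⟩ := mem_closure_iff_seq_limit.mp
    (show x ∈ closure (LinearMap.range (K : X →ₗ[ℂ] Y) : Set Y) from hx)
  have hbound : ∀ n, ‖z n‖ ^ 2 ≤
      2 * B' * ∑' l, ‖inner ℂ x (v l)‖ ^ 2 + 2 * B' * (B * ‖z n - x‖ ^ 2) := by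
    intro n
    obtain ⟨y, hy⟩ := hz n
    have h1 := hran y
    rw [show K y = z n from hy] at h1
    have h2 : ∑' l, ‖inner ℂ (z n) (v l)‖ ^ 2 ≤
        2 * ∑' l, ‖inner ℂ x (v l)‖ ^ 2 + 2 * ∑' l, ‖inner ℂ (z n - x) (v l)‖ ^ 2 := by
      rw [← tsum_mul_left, ← tsum_mul_left,
        ← Summable.tsum_add ((hBv x).1.mul_left _) ((hBv (z n - x)).1.mul_left _)]
      exact (hBv (z n)).1.tsum_le_tsum (fun l => norm_inner_sq_le_two_mul (z n) x (v l))
        (((hBv x).1.mul_left _).add ((hBv (z n - x)).1.mul_left _))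
    have h3 := (hBv (z n - x)).2
    nlinarith
  have hl2 : Filter.Tendsto (fun n => 2 * B' * ∑' l, ‖inner ℂ x (v l)‖ ^ 2 +
      2 * B' * (B * ‖z n - x‖ ^ 2)) Filter.atTop
      (nhds (2 * B' * ∑' l, ‖inner ℂ x (v l)‖ ^ 2 + 2 * B' * (B * 0 ^ 2))) :=
    ((((tendsto_iff_norm_sub_tendsto_zero.mp hlim).pow 2).const_mul B).const_mul (2 * B')).const_add _
  have h := le_of_tendsto_of_tendsto' (hlim.norm.pow 2) hl2 hbound
  simpa using h

lemma IsFrameOver.frameInf_pos {H : Submodule ℂ X} {w : Λ → X} (hw : IsFrameOver H w) {l : Λ}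
    (hl : w l ≠ 0) : 0 < frameInf H w := by
  obtain ⟨A, B, hA, _, hAB⟩ := hw.bounds
  refine lt_of_lt_of_le (Real.sqrt_pos.mpr hA) (le_csInf ?_ ?_)
  · refine ⟨_, ((‖w l‖ : ℂ)⁻¹) • w l, H.smul_mem _ (hw.mem l), ?_, rfl⟩
    rw [norm_smul, norm_inv, Complex.norm_real, norm_norm,
      inv_mul_cancel₀ (norm_ne_zero_iff.mpr hl)]
  · rintro r ⟨x, hx, hx1, rfl⟩
    have := (hAB x hx).2.1
    rw [hx1, one_pow, mul_one] at this
    exact Real.sqrt_le_sqrt this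

/-- For a geometric sequence `δ*_j = c β ^ j` the intervals `[δ*_j, β⁻¹ δ*_j]` abut. -/
lemma Ioc_subset_iUnion_Icc_geometric {c β : ℝ} (hc : 0 < c) (hβ0 : 0 < β) (hβ1 : β < 1) :
    Ioc 0 c ⊆ ⋃ n : ℕ, Icc (c * β ^ (n + 1)) (β⁻¹ * (c * β ^ (n + 1))) := by
  intro δ hδ
  obtain ⟨n, h1, h2⟩ := exists_nat_pow_near_of_lt_one (div_pos hδ.1 hc)
    ((div_le_one hc).mpr hδ.2) hβ0 hβ1
  refine mem_iUnion.mpr ⟨n, ?_, ?_⟩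
  · rw [lt_div_iff₀ hc] at h1
    linarith
  · rw [div_le_iff₀ hc] at h2
    rw [pow_succ]
    calc δ ≤ β ^ n * c := h2
      _ = β⁻¹ * (c * (β ^ n * β)) := by field_simp

/-- A biorthogonal pair of Bessel families turns an orthonormal basis into a diagonal frame
decomposition. -/
lemma isDFD_of_biorthogonal_bessel [CompleteSpace X] [CompleteSpace Y] (K : X →L[ℂ] Y)
    (hker : LinearMap.ker (K : X →ₗ[ℂ] Y) = ⊥) (u : HilbertBasis Λ ℂ X) {v w : Λ → Y} {κ : Λ → ℝ}
    (hκ : ∀ l, 0 < κ l) (hmem : ∀ l, v l ∈ LinearMap.range (K : X →ₗ[ℂ] Y))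
    (hv : ∀ l, ContinuousLinearMap.adjoint K (v l) = (κ l : ℂ) • u l)
    (hw : ∀ l, K (u l) = (κ l : ℂ) • w l) {B B' : ℝ} (hB : 0 < B) (hB' : 0 < B')
    (hBv : ∀ x, Summable (fun l => ‖inner ℂ x (v l)‖ ^ 2) ∧
      ∑' l, ‖inner ℂ x (v l)‖ ^ 2 ≤ B * ‖x‖ ^ 2)
    (hBw : ∀ x, Summable (fun l => ‖inner ℂ x (w l)‖ ^ 2) ∧
      ∑' l, ‖inner ℂ x (w l)‖ ^ 2 ≤ B' * ‖x‖ ^ 2) :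
    IsDFD K (fun l => u l) v κ where
  frame_u := by
    refine ⟨fun l => by rw [hker, Submodule.bot_orthogonal_eq_top]; trivial, 1, 1, one_pos,
      one_pos, fun x _ => ?_⟩
    have h := u.hasSum_norm_inner_sq x
    rw [h.tsum_eq, one_mul]
    exact ⟨h.summable, le_rfl, le_rfl⟩
  frame_v := by
    refine ⟨fun l => Submodule.le_topologicalClosure _ (hmem l), (2 * B')⁻¹, B, by positivity, hB,
      fun x hx => ⟨(hBv x).1, ?_, (hBv x).2⟩⟩
    rw [inv_mul_le_iff₀ (by positivity)]
    exact norm_sq_le_of_biorthogonal_bessel K u hv hw hB' hBv hBw hx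
  kappa_pos := hκ
  quasi_singular := hv

end AbstractFrames

/-! ### Symbol bounds on the annuli -/

lemma waveletKappa_pos (l : ℤ × ℤ) : 0 < waveletKappa l := by
  unfold waveletKappa
  split_ifs <;> positivity

lemma waveletKappa_le_one (l : ℤ × ℤ) : waveletKappa l ≤ 1 := by
  unfold waveletKappa
  split_ifs with h
  · exact zpow_le_one_of_nonpos₀ one_le_two (by omega)
  · exact le_rfl

lemma waveletKappa_of_one_le {j : ℤ} (h : 1 ≤ j) :
    waveletKappa (j, 0) = (((2 : ℝ) ^ j) ^ 2)⁻¹ := by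
  rw [waveletKappa, if_pos h, ← zpow_natCast, ← zpow_mul, ← zpow_neg]
  congr 1
  push_cast
  ring

lemma waveletKappa_mul_sq_le_one (j : ℤ) : waveletKappa (j, 0) * ((2 : ℝ) ^ j) ^ 2 ≤ 1 := by
  by_cases h : 1 ≤ j
  · rw [waveletKappa_of_one_le h, inv_mul_cancel₀ (by positivity)]
  · rw [waveletKappa, if_neg h, one_mul]
    have hj : j ≤ 0 := Int.lt_add_one_iff.mp (not_le.mp h)
    exact pow_le_one₀ (by positivity) (zpow_le_one_of_nonpos₀ one_le_two hj)

/-- On the annuli, `κ_λ E_{γ,1}(-|ω|² T ^ γ)⁻¹` is bounded above. -/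
lemma kappa_mul_inv_fracSymbol_le {γ T a b : ℝ} (hγ0 : 0 < γ) (hγ1 : γ < 1) (hT : 0 < T)
    {j : ℤ} {ξ : ℝ} (hξ : ξ ∈ annulus a b j) :
    |waveletKappa (j, 0) * (fracSymbol γ T ξ)⁻¹| ≤ 1 + Real.Gamma (1 - γ) * (b ^ 2 * T ^ γ) := by
  have hΓ := Real.Gamma_pos_of_pos (sub_pos.mpr hγ1)
  have hm := fracSymbol_pos hγ0 hγ1 hT.le ξ
  have hκ := waveletKappa_pos (j, 0)
  have hT' : 0 < T ^ γ := Real.rpow_pos_of_pos hT γ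
  have hx := fracSymbol_arg_nonneg γ hT.le ξ
  have h1 : (fracSymbol γ T ξ)⁻¹ ≤ 1 + Real.Gamma (1 - γ) * (|2 * Real.pi * ξ| ^ 2 * T ^ γ) := by
    have h := le_mittagLeffler_neg hγ0 hγ1 hx
    rw [one_div] at h
    exact inv_le_of_inv_le₀ (by positivity) h
  have h2 : waveletKappa (j, 0) * |2 * Real.pi * ξ| ^ 2 ≤ b ^ 2 := by
    calc waveletKappa (j, 0) * |2 * Real.pi * ξ| ^ 2
        ≤ waveletKappa (j, 0) * (b * 2 ^ j) ^ 2 := by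
          have := hξ.2
          gcongr
      _ = b ^ 2 * (waveletKappa (j, 0) * ((2 : ℝ) ^ j) ^ 2) := by ring
      _ ≤ b ^ 2 * 1 := by
          have := waveletKappa_mul_sq_le_one j
          gcongr
      _ = b ^ 2 := mul_one _
  rw [abs_of_pos (by positivity)]
  calc waveletKappa (j, 0) * (fracSymbol γ T ξ)⁻¹
      ≤ waveletKappa (j, 0) * (1 + Real.Gamma (1 - γ) * (|2 * Real.pi * ξ| ^ 2 * T ^ γ)) := by
        gcongr
    _ = waveletKappa (j, 0) +
        Real.Gamma (1 - γ) * ((waveletKappa (j, 0) * |2 * Real.pi * ξ| ^ 2) * T ^ γ) := by ring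
    _ ≤ 1 + Real.Gamma (1 - γ) * (b ^ 2 * T ^ γ) := by
        have := waveletKappa_le_one (j, 0)
        gcongr

/-- On the annuli, `κ_λ⁻¹ E_{γ,1}(-|ω|² T ^ γ)` is bounded above. -/
lemma inv_kappa_mul_fracSymbol_le {γ T a b : ℝ} (hγ0 : 0 < γ) (hγ1 : γ < 1) (hT : 0 < T)
    (ha : 0 < a) {j : ℤ} {ξ : ℝ} (hξ : ξ ∈ annulus a b j) :
    |(waveletKappa (j, 0))⁻¹ * fracSymbol γ T ξ| ≤
      1 + Real.Gamma (1 + γ) / (a ^ 2 * T ^ γ) := by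
  have hΓ := Real.Gamma_pos_of_pos (add_pos one_pos hγ0)
  have hm := fracSymbol_pos hγ0 hγ1 hT.le ξ
  have hκ := waveletKappa_pos (j, 0)
  have hT' : 0 < T ^ γ := Real.rpow_pos_of_pos hT γ
  have hx := fracSymbol_arg_nonneg γ hT.le ξ
  have hpos : 0 ≤ Real.Gamma (1 + γ) / (a ^ 2 * T ^ γ) := by positivity
  rw [abs_of_pos (by positivity)]
  by_cases h : 1 ≤ j
  · have hκj := waveletKappa_of_one_le h
    have hξ0 : 0 < a * 2 ^ j := by positivity
    have hle : fracSymbol γ T ξ ≤ Real.Gamma (1 + γ) / ((a * 2 ^ j) ^ 2 * T ^ γ) := by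
      refine (mittagLeffler_neg_le hγ0 hγ1 hx).trans ?_
      rw [div_le_div_iff₀ (by positivity) (by positivity), one_mul, mul_add, mul_one,
        mul_div_cancel₀ _ hΓ.ne']
      have : (a * 2 ^ j) ^ 2 * T ^ γ ≤ |2 * Real.pi * ξ| ^ 2 * T ^ γ := by
        have := hξ.1
        gcongr
      linarith
    rw [hκj, inv_inv]
    have h2 : ((2 : ℝ) ^ j) ^ 2 * fracSymbol γ T ξ ≤ Real.Gamma (1 + γ) / (a ^ 2 * T ^ γ) := by
      calc ((2 : ℝ) ^ j) ^ 2 * fracSymbol γ T ξ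
          ≤ ((2 : ℝ) ^ j) ^ 2 * (Real.Gamma (1 + γ) / ((a * 2 ^ j) ^ 2 * T ^ γ)) := by gcongr
        _ = Real.Gamma (1 + γ) / (a ^ 2 * T ^ γ) := by field_simp
    linarith
  · rw [waveletKappa, if_neg h, inv_one, one_mul]
    have := (le_abs_self _).trans (abs_fracSymbol_le_one hγ0 hγ1 hT.le ξ)
    linarith

/-- On the annuli, `κ_λ ^ (-p/2) (1 + ξ²) ^ (-p/2)` is bounded above. -/
lemma kappa_rpow_mul_bessel_le {p a b : ℝ} (hp : 0 ≤ p) (ha : 0 < a) {j : ℤ} {ξ : ℝ}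
    (hξ : ξ ∈ annulus a b j) :
    |waveletKappa (j, 0) ^ (-(p / 2)) * (1 + ‖ξ‖ ^ 2) ^ (-(p / 2))| ≤
      1 + ((a / (2 * Real.pi)) ^ 2) ^ (-(p / 2)) := by
  have hκ := waveletKappa_pos (j, 0)
  have hpos : 0 ≤ ((a / (2 * Real.pi)) ^ 2) ^ (-(p / 2)) := by positivity
  have hp2 : -(p / 2) ≤ 0 := by linarith
  rw [abs_of_nonneg (by positivity), ← Real.mul_rpow hκ.le (by positivity)]
  by_cases h : 1 ≤ j
  · have hκj := waveletKappa_of_one_le h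
    have h1 : a * 2 ^ j / (2 * Real.pi) ≤ ‖ξ‖ := by
      have h2 := hξ.1
      rw [abs_mul, abs_of_pos (by positivity : 0 < 2 * Real.pi)] at h2
      rw [div_le_iff₀ (by positivity), mul_comm ‖ξ‖]
      exact h2
    have h2 : (a / (2 * Real.pi)) ^ 2 ≤ waveletKappa (j, 0) * (1 + ‖ξ‖ ^ 2) := by
      rw [hκj]
      calc (a / (2 * Real.pi)) ^ 2
          = (((2 : ℝ) ^ j) ^ 2)⁻¹ * (a * 2 ^ j / (2 * Real.pi)) ^ 2 := by field_simp
        _ ≤ (((2 : ℝ) ^ j) ^ 2)⁻¹ * (1 + ‖ξ‖ ^ 2) := by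
            have : (a * 2 ^ j / (2 * Real.pi)) ^ 2 ≤ ‖ξ‖ ^ 2 := by gcongr
            gcongr
            linarith
    have := Real.rpow_le_rpow_of_nonpos (by positivity) h2 hp2
    linarith
  · rw [waveletKappa, if_neg h, one_mul]
    have : (1 + ‖ξ‖ ^ 2) ^ (-(p / 2)) ≤ 1 :=
      Real.rpow_le_one_of_one_le_of_nonpos (by nlinarith [sq_nonneg ‖ξ‖]) hp2
    linarith

/-! ### Covering of the noise levels -/

/-- Along the fine scales `λ = (n + 1, 0)` the levels `δ*_λ` form a geometric sequence with ratio
`β = 2 ^ (-(2 + p))`. -/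
lemma exists_Ioc_subset_iUnion_dSet {X Y : Type*} [NormedAddCommGroup X] [InnerProductSpace ℂ X]
    [CompleteSpace X] [NormedAddCommGroup Y] [InnerProductSpace ℂ Y] [CompleteSpace Y]
    {K : X →L[ℂ] Y} {u : ℤ × ℤ → X} {v : ℤ × ℤ → Y} (h : IsDFD K u v waveletKappa)
    (hu : u (0, 0) ≠ 0) {p E : ℝ} (hp : 0 ≤ p) (hE : 0 < E) :
    ∃ δ₀ : ℝ, 0 < δ₀ ∧ Ioc 0 δ₀ ⊆ ⋃ l : ℤ × ℤ,
      dSet K v waveletKappa (fun μ => μ ^ (p / 2)) E ((2 : ℝ) ^ (-(2 + p))) l := by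
  have hv0 : v (0, 0) ≠ 0 := fun h0 => by
    have h1 := h.quasi_singular (0, 0)
    rw [h0, map_zero] at h1
    exact smul_ne_zero (Complex.ofReal_ne_zero.mpr (waveletKappa_pos _).ne') hu h1.symm
  have hF := h.frame_v.frameInf_pos hv0
  set β : ℝ := (2 : ℝ) ^ (-(2 + p)) with hβ
  have hβ0 : 0 < β := by positivity
  have hβ1 : β < 1 := Real.rpow_lt_one_of_one_lt_of_neg one_lt_two (by linarith)
  set c : ℝ := (frameInf (LinearMap.range (K : X →ₗ[ℂ] Y)).topologicalClosure v)⁻¹ * E with hc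
  have hc0 : 0 < c := by positivity
  have hδ : ∀ n : ℕ, deltaStar K v waveletKappa (fun μ => μ ^ (p / 2)) E ((n : ℤ) + 1, 0) =
      c * β ^ (n + 1) := by
    intro n
    have hκ : waveletKappa ((n : ℤ) + 1, 0) = (2 : ℝ) ^ (-(2 * ((n : ℝ) + 1))) := by
      rw [waveletKappa_of_one_le (by omega), Real.rpow_neg zero_le_two,
        show 2 * ((n : ℝ) + 1) = ((((n : ℤ) + 1) * 2 : ℤ) : ℝ) by push_cast; ring,
        Real.rpow_intCast, zpow_mul]
      norm_cast
    rw [deltaStar, hκ, hβ, ← Real.rpow_natCast (2 ^ (-(2 + p))), ← Real.rpow_natCast _ 2,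
      ← Real.rpow_mul zero_le_two, ← Real.rpow_mul zero_le_two, ← Real.rpow_mul zero_le_two,
      ← Real.rpow_add two_pos, Real.sqrt_eq_rpow, ← Real.rpow_mul zero_le_two]
    congr 2
    push_cast
    ring
  refine ⟨c, hc0, (Ioc_subset_iUnion_Icc_geometric hc0 hβ0 hβ1).trans
    (iUnion_subset fun n => ?_)⟩
  refine Subset.trans ?_ (subset_iUnion _ ((n : ℤ) + 1, (0 : ℤ)))
  rw [dSet, hδ]

/-! ### Sobolev functions and source sets -/

/-- A Sobolev function of order `p ≥ 0` has Fourier transform `(1 + ξ²) ^ (-p/2) F` with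
`F ∈ L²`; the identity of tempered distributions becomes one of functions because multiplication by
the bounded weight `(1 + ξ²) ^ (-p/2)` preserves `L²`. -/
lemma fourier_eq_of_memSobolev {p : ℝ} (hp : 0 ≤ p) {θ : L2R}
    (hθ : TemperedDistribution.MemSobolev p 2 (θ : 𝓢'(ℝ, ℂ))) :
    ∃ F : L2R, ((𝓕 θ : L2R) : ℝ → ℂ) =ᵐ[volume]
      fun ξ => (((1 + ‖ξ‖ ^ 2) ^ (-(p / 2)) : ℝ) : ℂ) * F ξ := by
  obtain ⟨F, hF⟩ := TemperedDistribution.memSobolev_iff_exists_smulLeftCLM_fourier.mp hθ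
  rw [Lp.fourier_toTemperedDistribution_eq] at hF
  have hg₁ : (fun ξ : ℝ => (((1 + ‖ξ‖ ^ 2) ^ (-(p / 2)) : ℝ) : ℂ)).HasTemperateGrowth := by
    fun_prop
  have hg₂ : MemLp (fun ξ : ℝ => (((1 + ‖ξ‖ ^ 2) ^ (-(p / 2)) : ℝ) : ℂ)) ∞ volume := by
    refine memLp_top_of_bound hg₁.1.continuous.aestronglyMeasurable 1
      (Filter.Eventually.of_forall fun ξ => ?_)
    rw [Complex.norm_real, Real.norm_of_nonneg (by positivity)]
    exact Real.rpow_le_one_of_one_le_of_nonpos (by nlinarith [sq_nonneg ‖ξ‖]) (by linarith)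
  have hsmul := Lp.toTemperedDistribution_smul_eq (r := 2) hg₁ hg₂ F
  rw [← hF, TemperedDistribution.smulLeftCLM_smulLeftCLM_apply (by fun_prop) (by fun_prop)] at hsmul
  have h1 : ((fun ξ : ℝ => (((1 + ‖ξ‖ ^ 2) ^ (-(p / 2)) : ℝ) : ℂ)) *
      fun ξ : ℝ => (((1 + ‖ξ‖ ^ 2) ^ (p / 2) : ℝ) : ℂ)) = fun _ => 1 := by
    ext ξ
    rw [Pi.mul_apply, ← Complex.ofReal_mul, ← Real.rpow_add (by positivity), neg_add_cancel,
      Real.rpow_zero, Complex.ofReal_one]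
  have h2 : ((hg₂.toLp _ • F : L2R) : 𝓢'(ℝ, ℂ)) = (𝓕 θ : L2R) := by
    rw [hsmul]
    rw [mul_comm, h1]
    rw [TemperedDistribution.smulLeftCLM_const, one_smul]
  have hinj : Function.Injective (Lp.toTemperedDistributionCLM ℂ (volume : Measure ℝ) 2) :=
    LinearMap.ker_eq_bot.mp Lp.ker_toTemperedDistributionCLM_eq_bot
  have h3 : (hg₂.toLp _ • F : L2R) = 𝓕 θ := hinj h2
  refine ⟨F, ?_⟩
  rw [← h3]
  filter_upwards [Lp.coeFn_lpSMul (r := 2) (hg₂.toLp _) F, hg₂.coeFn_toLp] with ξ h4 h5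
  rw [h4, Pi.smul_apply', h5, smul_eq_mul]

lemma fourier_const_smul_fourierMul {m : ℝ → ℝ}
    (hm : MemLp (fun ξ => (m ξ : ℂ)) ∞ (volume : Measure ℝ)) (c : ℝ) (f : L2R) :
    ((𝓕 ((c : ℂ) • fourierMul m hm f) : L2R) : ℝ → ℂ) =ᵐ[volume]
      fun ξ => ((c * m ξ : ℝ) : ℂ) * (𝓕 f : L2R) ξ := by
  have h : (𝓕 ((c : ℂ) • fourierMul m hm f) : L2R) = (c : ℂ) • 𝓕 (fourierMul m hm f) :=
    (Lp.fourierTransformₗᵢ ℝ ℂ).map_smul _ _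
  rw [h]
  filter_upwards [fourier_fourierMul hm f, Lp.coeFn_smul (c : ℂ) (𝓕 (fourierMul m hm f) : L2R)]
    with ξ h1 h2
  rw [h2, Pi.smul_apply, h1, smul_eq_mul]
  push_cast
  ring

/-- With `𝓕 θ = (1 + ξ²) ^ (-p/2) F` and `g = 𝓕⁻¹ F`, the weighted coefficients
`κ_λ ^ (-p/2) ⟨θ, u_λ⟩` are `⟨g, w_λ⟩` for a band-limited Bessel family `w`. -/
lemma mem_sourceSet_of_memSobolev {a b : ℝ} (ha : 0 < a) {u : ℤ × ℤ → L2R}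
    (hu : Orthonormal ℂ u)
    (hband : ∀ l, ∀ᵐ ξ : ℝ, (𝓕 (u l) : L2R) ξ ≠ 0 → ξ ∈ annulus a b l.1)
    {p : ℝ} (hp : 0 ≤ p) {θ : L2R}
    (hθ : TemperedDistribution.MemSobolev p 2 (θ : 𝓢'(ℝ, ℂ))) :
    ∃ E₀ : ℝ, 0 < E₀ ∧ ∀ E : ℝ, E₀ ≤ E →
      θ ∈ sourceSet u waveletKappa (fun μ => μ ^ (p / 2)) E := by
  obtain ⟨F, hF⟩ := fourier_eq_of_memSobolev hp hθ
  obtain ⟨N, hN⟩ := pow_unbounded_of_one_lt (b / a) one_lt_two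
  rw [div_lt_iff₀ ha, mul_comm] at hN
  set m : ℝ → ℝ := fun ξ => (1 + ‖ξ‖ ^ 2) ^ (-(p / 2)) with hm
  have hmm : Measurable m := by fun_prop
  have hm1 : ∀ ξ, |m ξ| ≤ 1 := fun ξ => by
    rw [abs_of_nonneg (by positivity)]
    exact Real.rpow_le_one_of_one_le_of_nonpos (by nlinarith [sq_nonneg ‖ξ‖]) (by linarith)
  have hmL := memLp_top_ofReal hmm hm1
  set c : ℤ → ℝ := fun j => waveletKappa (j, 0) ^ (-(p / 2)) with hc
  set g : L2R := (Lp.fourierTransformₗᵢ ℝ ℂ).symm F with hg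
  have hgF : (𝓕 g : L2R) = F := (Lp.fourierTransformₗᵢ ℝ ℂ).apply_symm_apply F
  have hθg : θ = fourierMul m hmL g := by
    refine L2R.ext_fourier ?_
    filter_upwards [hF, fourier_fourierMul hmL g] with ξ h1 h2
    rw [h1, h2, hgF]
  have hbes := bessel_of_annulus_support (w := fun l => (c l.1 : ℂ) • fourierMul m hmL (u l))
    (W := fun j ξ => c j * m ξ) ha hN hu (fun j => hmm.const_mul _)
    (C := 1 + ((a / (2 * Real.pi)) ^ 2) ^ (-(p / 2))) (by positivity)
    (fun j ξ hξ => kappa_rpow_mul_bessel_le hp ha hξ) hband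
    (fun l => fourier_const_smul_fourierMul hmL (c l.1) (u l)) g
  have hterm : ∀ l, ‖inner ℂ g ((c l.1 : ℂ) • fourierMul m hmL (u l))‖ ^ 2 =
      ((waveletKappa l ^ 2) ^ (p / 2))⁻¹ * ‖inner ℂ θ (u l)‖ ^ 2 := by
    intro l
    have hκ := waveletKappa_pos l
    have hcl : c l.1 = waveletKappa l ^ (-(p / 2)) := rfl
    rw [inner_smul_right, ← inner_fourierMul_left, ← hθg, norm_mul, mul_pow, Complex.norm_real,
      Real.norm_eq_abs, sq_abs, hcl, Real.rpow_neg hκ.le, inv_pow, ← Real.rpow_natCast,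
      ← Real.rpow_natCast (waveletKappa l), ← Real.rpow_mul hκ.le, ← Real.rpow_mul hκ.le]
    congr 3
    ring
  simp only [hterm] at hbes
  set S := ∑' l, ((waveletKappa l ^ 2) ^ (p / 2))⁻¹ * ‖inner ℂ θ (u l)‖ ^ 2
  have hS : 0 ≤ S := tsum_nonneg fun l => by
    have := waveletKappa_pos l
    positivity
  refine ⟨S + 1, by linarith, fun E hE => ⟨hbes.1, ?_⟩⟩
  change S ≤ E ^ 2
  nlinarith

/-! ### Vaguelettes and the diagonal frame decomposition -/

theorem mainTheorem6 (γ T : ℝ) (hγ0 : 0 < γ) (hγ1 : γ < 1) (hT : 0 < T) :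
    (∃! K : L2R →L[ℂ] L2R, IsFinalStateOperator γ T K) ∧
    ∀ K : L2R →L[ℂ] L2R, IsFinalStateOperator γ T K →
    ∀ (ψ : L2R) (u : HilbertBasis (ℤ × ℤ) ℂ L2R),
      (∀ l, (u l : ℝ → ℂ) =ᵐ[volume] waveletFun ψ l) →
    ∀ a_u b_u : ℝ, 0 < a_u → 0 < b_u →
      -- the support of the Fourier transform of the mother wavelet lies in an annulus
      (∀ᵐ ξ : ℝ, (𝓕 ψ : L2R) ξ ≠ 0 →
        a_u ≤ |2 * Real.pi * ξ| ∧ |2 * Real.pi * ξ| ≤ b_u) →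
      -- membership of Sobolev functions in the source sets
      (∀ p : ℝ, 0 ≤ p → ∀ θ₀ : L2R,
        TemperedDistribution.MemSobolev p 2 (θ₀ : 𝓢'(ℝ, ℂ)) →
        ∃ E₀ : ℝ, 0 < E₀ ∧ ∀ E : ℝ, E₀ ≤ E →
          θ₀ ∈ sourceSet (fun l => u l) waveletKappa (fun μ => μ ^ (p / 2)) E) ∧
      ∃ σ v : ℤ × ℤ → L2R,
        -- the vaguelettes `v_λ = κ_λ K 𝓕⁻¹ (|E_{γ,1}|⁻² 𝓕 u_λ)` and their Fourier transforms
        (∀ l, ((𝓕 (σ l) : L2R) : ℝ → ℂ) =ᵐ[volume]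
          fun ξ => (((|fracSymbol γ T ξ| ^ 2)⁻¹ : ℝ) : ℂ) * (𝓕 (u l) : L2R) ξ) ∧
        (∀ l, v l = (waveletKappa l : ℂ) • K (σ l)) ∧
        (∀ l, ((𝓕 (v l) : L2R) : ℝ → ℂ) =ᵐ[volume]
          fun ξ => ((waveletKappa l * (fracSymbol γ T ξ)⁻¹ : ℝ) : ℂ) * (𝓕 (u l) : L2R) ξ) ∧
        -- the diagonal frame decomposition
        IsDFD K (fun l => u l) v waveletKappa ∧
        -- the intervals `D_{λ,β}` cover all small noise levels
        (∀ p : ℝ, 0 ≤ p → ∀ E : ℝ, 0 < E → ∃ δ₀ : ℝ, 0 < δ₀ ∧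
          Ioc 0 δ₀ ⊆ ⋃ l : ℤ × ℤ,
            dSet K v waveletKappa (fun μ => μ ^ (p / 2)) E ((2 : ℝ) ^ (-(2 + p))) l) := by
  have hfin := isFinalStateOperator_fracHeat hγ0 hγ1 hT
  refine ⟨⟨_, hfin, fun K hK => hK.unique hfin⟩, ?_⟩
  intro K hK ψ u hu a b ha hb hψ
  have hband : ∀ l, ∀ᵐ ξ : ℝ, (𝓕 (u l) : L2R) ξ ≠ 0 → ξ ∈ annulus a b l.1 := fun l =>
    fourier_wavelet_support (hu l) hψ
  refine ⟨fun p hp θ₀ hθ => mem_sourceSet_of_memSobolev ha u.orthonormal hband hp hθ, ?_⟩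
  obtain ⟨N, hN⟩ := pow_unbounded_of_one_lt (b / a) one_lt_two
  rw [div_lt_iff₀ ha, mul_comm] at hN
  set m := fracSymbol γ T
  have hmm : Measurable m := measurable_fracSymbol hγ0 T
  have hm0 : ∀ ξ, 0 < m ξ := fracSymbol_pos hγ0 hγ1 hT.le
  have hmL := memLp_fracSymbol hγ0 hγ1 hT.le
  have hKm : K = fourierMul m hmL := hK.unique hfin
  have hT' : 0 < T ^ γ := Real.rpow_pos_of_pos hT γ
  have hκ := waveletKappa_pos
  set C := 1 + Real.Gamma (1 - γ) * (b ^ 2 * T ^ γ)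
  have hC0 : 0 < C := by
    have := Real.Gamma_pos_of_pos (sub_pos.mpr hγ1)
    positivity
  set C' := 1 + Real.Gamma (1 + γ) / (a ^ 2 * T ^ γ)
  have hC'0 : 0 < C' := by
    have := Real.Gamma_pos_of_pos (add_pos one_pos hγ0)
    positivity
  -- the unbounded symbol `|E|⁻²` is cut off outside the annulus that carries `𝓕 u_λ`
  set q : ℤ → ℝ → ℝ := fun j => (annulus a b j).indicator fun ξ => (|m ξ| ^ 2)⁻¹ with hq
  have hqm : ∀ j, Measurable (q j) := fun j =>
    (by fun_prop : Measurable fun ξ => (|m ξ| ^ 2)⁻¹).indicator (measurableSet_annulus a b j)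
  have hqC : ∀ j ξ, |q j ξ| ≤ ((waveletKappa (j, 0))⁻¹ * C) ^ 2 := by
    intro j ξ
    by_cases hξ : ξ ∈ annulus a b j
    · have h1 := (le_abs_self _).trans (kappa_mul_inv_fracSymbol_le hγ0 hγ1 hT hξ)
      have h2 : (m ξ)⁻¹ ≤ (waveletKappa (j, 0))⁻¹ * C := by
        rw [inv_mul_eq_div, le_div_iff₀ (hκ _), mul_comm]
        exact h1
      have h3 := inv_pos.mpr (hm0 ξ)
      simp only [hq, indicator_of_mem hξ]
      rw [abs_of_nonneg (by positivity), abs_of_pos (hm0 ξ), ← inv_pow]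
      gcongr
    · simp only [hq, indicator_of_notMem hξ, abs_zero]
      positivity
  set σ : ℤ × ℤ → L2R := fun l => fourierMul (q l.1) (memLp_top_ofReal (hqm l.1) (hqC l.1)) (u l)
  set v : ℤ × ℤ → L2R := fun l => (waveletKappa l : ℂ) • K (σ l) with hv
  have hσ : ∀ l, ((𝓕 (σ l) : L2R) : ℝ → ℂ) =ᵐ[volume]
      fun ξ => (((|m ξ| ^ 2)⁻¹ : ℝ) : ℂ) * (𝓕 (u l) : L2R) ξ := by
    intro l
    filter_upwards [fourier_fourierMul (memLp_top_ofReal (hqm l.1) (hqC l.1)) (u l), hband l]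
      with ξ h1 h2
    rw [h1]
    rcases eq_or_ne ((𝓕 (u l) : L2R) ξ) 0 with h0 | h0
    · rw [h0]; simp
    · simp only [hq, indicator_of_mem (h2 h0)]
  have hvF : ∀ l, ((𝓕 (v l) : L2R) : ℝ → ℂ) =ᵐ[volume]
      fun ξ => ((waveletKappa l * (m ξ)⁻¹ : ℝ) : ℂ) * (𝓕 (u l) : L2R) ξ := by
    intro l
    simp only [hv, hKm]
    filter_upwards [fourier_const_smul_fourierMul hmL (waveletKappa l) (σ l), hσ l] with ξ h1 h2
    rw [h1, h2, ← mul_assoc, ← Complex.ofReal_mul, abs_of_pos (hm0 ξ)]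
    congr 2
    change waveletKappa l * m ξ * (m ξ ^ 2)⁻¹ = _
    have := (hm0 ξ).ne'
    field_simp
  -- the dual family of the vaguelettes
  set w : ℤ × ℤ → L2R := fun l => ((((waveletKappa l)⁻¹ : ℝ)) : ℂ) • K (u l) with hw
  have hwF : ∀ l, ((𝓕 (w l) : L2R) : ℝ → ℂ) =ᵐ[volume]
      fun ξ => (((waveletKappa l)⁻¹ * m ξ : ℝ) : ℂ) * (𝓕 (u l) : L2R) ξ := by
    intro l
    simp only [hw, hKm]
    exact fourier_const_smul_fourierMul hmL _ (u l)
  have hbv := bessel_of_annulus_support (w := v) (W := fun j ξ => waveletKappa (j, 0) * (m ξ)⁻¹)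
    ha hN u.orthonormal (fun j => hmm.inv.const_mul _) hC0.le
    (fun j ξ hξ => kappa_mul_inv_fracSymbol_le hγ0 hγ1 hT hξ) hband hvF
  have hbw := bessel_of_annulus_support (w := w) (W := fun j ξ => (waveletKappa (j, 0))⁻¹ * m ξ)
    ha hN u.orthonormal (fun j => hmm.const_mul _) hC'0.le
    (fun j ξ hξ => inv_kappa_mul_fracSymbol_le hγ0 hγ1 hT ha hξ) hband hwF
  have hKadj : ContinuousLinearMap.adjoint K = K := by rw [hKm, adjoint_fourierMul]
  have hquasi : ∀ l, ContinuousLinearMap.adjoint K (v l) = (waveletKappa l : ℂ) • u l := by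
    intro l
    rw [hKadj]
    simp only [hv, hKm, map_smul]
    congr 1
    refine L2R.ext_fourier ?_
    filter_upwards [fourier_fourierMul hmL (fourierMul m hmL (σ l)),
      fourier_fourierMul hmL (σ l), hσ l] with ξ h1 h2 h3
    rw [h1, h2, h3, ← mul_assoc, ← mul_assoc, ← Complex.ofReal_mul, ← Complex.ofReal_mul,
      abs_of_pos (hm0 ξ), ← sq, mul_inv_cancel₀ (pow_ne_zero 2 (hm0 ξ).ne'), Complex.ofReal_one,
      one_mul]
  have hdual : ∀ l, K (u l) = (waveletKappa l : ℂ) • w l := by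
    intro l
    simp only [hw]
    rw [smul_smul, ← Complex.ofReal_mul, mul_inv_cancel₀ (hκ l).ne', Complex.ofReal_one, one_smul]
  have hker : LinearMap.ker (K : L2R →ₗ[ℂ] L2R) = ⊥ := by
    rw [hKm]
    exact ker_fourierMul hmL fun ξ => (hm0 ξ).ne'
  have hDFD : IsDFD K (fun l => u l) v waveletKappa :=
    isDFD_of_biorthogonal_bessel K hker u hκ
      (fun l => Submodule.smul_mem _ _ (LinearMap.mem_range_self (K : L2R →ₗ[ℂ] L2R) (σ l))) hquasi
      hdual (B := C ^ 2 * N + 1) (B' := C' ^ 2 * N + 1) (by positivity) (by positivity)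
      (fun x => ⟨(hbv x).1, (hbv x).2.trans (by gcongr; linarith)⟩)
      (fun x => ⟨(hbw x).1, (hbw x).2.trans (by gcongr; linarith)⟩)
  exact ⟨σ, v, hσ, fun l => rfl, hvF, hDFD, fun p hp E hE =>
    exists_Ioc_subset_iUnion_dSet hDFD (u.orthonormal.ne_zero (0, 0)) hp hE⟩
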